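/- Let $\varphi:\mathbb R^d\to\mathbb R$ be $K$-Lipschitz ($K\ge0$) and $\lambda$-concave with $\lambda\ge 0$, i.e. $y\mapsto\varphi(y)-\frac\lambda2|y|^2$ is concave. For $\varepsilon,t>0$ let $$u^\varepsilon_t(x)=-\varepsilon\log\left(\frac1{(2\pi\varepsilon t)^{d/2}}\int_{\mathbb R^d}\exp\Big(-\frac{|x-y|^2}{2\varepsilon t}-\frac{\varphi(y)}{\varepsilon}\Big)\,dy\right)$$ be the Cole–Hopf solution of $\partial_tu^\varepsilon+\frac12|\nabla u^\varepsilon|^2=\frac\varepsilon2\Delta u^\varepsilon$ with initial data $\varphi$, and let $$u_t(x)=\inf_{y\in\mathbb R^d}\Big(\frac{|x-y|^2}{2t}+\varphi(y)\Big)$$ be given by the Hopf–Lax formula. Then $u_t$ is $\lambda_t$-concave with $\lambda_t=\lambda/(1+\lambda t)$, and we put $$\partial u_t(x)=\Big\{q\in\mathbb R^d: u_t(z)\le u_t(x)+q\cdot(z-x)+\tfrac12\lambda_t|z-x|^2\ \text{ for all } z\in\mathbb R^d\Big\}.$$ For each $\varepsilon>0$ there is a unique viscous Lagrangian flow $X^\varepsilon:\mathbb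 R^d\times[0,\infty)\to\mathbb R^d$, meaning that for every $y$ the path $t\mapsto X^\varepsilon(y,t)$ is continuous on $[0,\infty)$, $X^\varepsilon(y,0)=y$, and $\partial_tX^\varepsilon(y,t)=\nabla u^\varepsilon_t(X^\varepsilon(y,t))$ for all $t>0$. Moreover: (a) The limit $X(y,t)=\lim_{\varepsilon\to0^+}X^\varepsilon(y,t)$ exists for each $y\in\mathbb R^d$, $t\ge0$, with uniform convergence on every compact subset of $\mathbb R^d\times[0,\infty)$. (b) For each $t\ge0$, $X_t=X(\cdot,t)$ maps $\mathbb R^d$ onto $\mathbb R^d$. (c) $X$ is locally Lipschitz on $\mathbb R^d\times[0,\infty)$, and more precisely: (i) for each $y$ the path $t\mapsto X_t(y)$ is $K$-Lipschitz on $[0,\infty)$; (ii) whenever $0\le s<t$, for all $y,z\in\mathbb R^d$, $$\frac{|X_t(y)-X_t(z)|}{1+\lambda t}\le\frac{|X_s(y)-X_s(z)|}{1+\lambda s}\le|y-z|,$$ and if $X_s(y)=X_s(z)$ for some $s\ge0$, then $X_t(y)=X_t(z)$ for all $t\ge s$. (d) For each $y\in\mathbb R^d$ the path $t\mapsto X_t(y)$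 is the unique Lipschitz function $x:[0,\infty)\to\mathbb R^d$ with $x_0=y$ and $\partial_tx_t\in\partial u_t(x_t)$ for a.e. $t>0$. -/

import Mathlib

open scoped NNReal

noncomputable section

namespace Adhesion

/-- Euclidean space `ℝ^d`. -/
abbrev Space (d : ℕ) : Type := EuclideanSpace ℝ (Fin d)

variable {d : ℕ}

/-- `f` is `lam`-concave: `y ↦ f y - (lam / 2) |y|²` is concave on `ℝ^d`. -/
def LambdaConcave (lam : ℝ) (f : Space d → ℝ) : Prop :=
  ConcaveOn ℝ Set.univ (fun y => f y - lam / 2 * ‖y‖ ^ 2)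

/-- The viscous potential `u^ε_t(x)`, for `ε, t > 0`, by the Cole-Hopf formula. -/
def viscousPotential (φ : Space d → ℝ) (ε t : ℝ) (x : Space d) : ℝ :=
  -ε * Real.log (1 / (2 * Real.pi * ε * t) ^ ((d : ℝ) / 2) *
    ∫ y : Space d, Real.exp (-‖x - y‖ ^ 2 / (2 * ε * t) - φ y / ε))

/-- `Z` is the Lagrangian flow, on the time interval `[0, ∞)`, of the viscous velocity field
`v^ε_t = ∇ u^ε_t`: each path `t ↦ Z y t` is continuous on `[0, ∞)`, starts at `y`, and satisfies
the differential equation at every `t > 0`. (The initial potential need not be differentiable, so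
the velocity is only defined for `t > 0`.) -/
structure IsViscousFlow (φ : Space d → ℝ) (ε : ℝ) (Z : Space d → ℝ → Space d) : Prop where
  initial : ∀ y, Z y 0 = y
  continuousOn : ∀ y, ContinuousOn (Z y) (Set.Ici 0)
  hasDerivAt : ∀ y, ∀ t > 0,
    HasDerivAt (Z y) (gradient (viscousPotential φ ε t) (Z y t)) t

/-- The inviscid potential `u_t(x)`, for `t > 0`, by the Hopf-Lax formula. -/
def hopfLax (φ : Space d → ℝ) (t : ℝ) (x : Space d) : ℝ :=
  ⨅ y : Space d, (‖x - y‖ ^ 2 / (2 * t) + φ y)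

/-- The differential `∂f(x)` of a `mu`-concave function `f`: the slopes at `x` of the paraboloids
with Hessian `mu • I` that lie above the graph of `f` and touch it at `x`. -/
def differential (mu : ℝ) (f : Space d → ℝ) (x : Space d) : Set (Space d) :=
  {q | ∀ z, f z ≤ f x + inner ℝ q (z - x) + mu / 2 * ‖z - x‖ ^ 2}

/-- `x` is a Lipschitz solution on `[0, ∞)` of the differential inclusion `∂_t x_t ∈ ∂u_t(x_t)`
for a.e. `t > 0`, `x_0 = y`, where `u_t` is the Hopf-Lax potential of the `lam`-concave function
`φ`; this `u_t` is `lam / (1 + lam * t)`-concave. -/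
structure IsLipschitzSolution (φ : Space d → ℝ) (lam : ℝ) (y : Space d) (x : ℝ → Space d) :
    Prop where
  lipschitz : ∃ L : ℝ≥0, LipschitzOnWith L x (Set.Ici 0)
  initial : x 0 = y
  inclusion : ∀ᵐ t ∂(MeasureTheory.volume.restrict (Set.Ioi (0 : ℝ))),
    ∃ v ∈ differential (lam / (1 + lam * t)) (hopfLax φ t) (x t), HasDerivAt x v t

end Adhesion

end

/-! By Cole–Hopf, `viscousPotential` is minus ε times the log of a Gibbs integral. Two bounds
survive as ε → 0: it is `K`-Lipschitz, and it is λ/(1+λt)-concave, because after completing the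
square the exponent is convex in x and log ∫ exp preserves convexity. A Laplace-type estimate with
explicit errors of order ε log ε shows that it converges to `hopfLax` uniformly on (0,T] × ℝ^d.

The engine is a stability estimate, `sq_norm_sub_le_of_mem_differential`. If two paths follow the
differentials of λ_t-concave type of potentials that differ by at most δ, then |x - y|²/(1+λt)²
grows at rate at most 4δ. The factor 1+λt is the integrating factor of the one-sided Lipschitz bound
with constant λ_t. For two viscous potentials with different ε this makes the flows Cauchy, at a
rate independent of the starting point. With δ = 0 it gives uniqueness, the contraction estimate and
stickiness.

Existence of the viscous flow needs care at t = 0, where the velocity need not extend continuously.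
In the time s = √t the field becomes bounded and Lipschitz up to s = 0, so Picard–Lindelöf applies
with a datum prescribed at any time, which also makes the viscous flow surjective.

The limit path is `K`-Lipschitz, hence differentiable almost everywhere. At such times
`mem_differential_of_tendsto` puts its velocity in the differential of `hopfLax`, by integrating the
paraboloid inequality along the viscous paths. Surjectivity passes to the limit by compactness,
since points move a distance at most Kt. -/

noncomputable section

namespace Adhesion

open MeasureTheory Set Filter Topology

variable {d : ℕ}

/-! ### Gaussian and Gibbs integrals, and the gradient of the Cole–Hopf potential. -/

theorem integrable_exp_neg_mul_sq_norm {a : ℝ} (ha : 0 < a) :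
    Integrable (fun z : Space d => Real.exp (-a * ‖z‖ ^ 2)) := by
  by_contra h
  have h1 := GaussianFourier.integral_rexp_neg_mul_sq_norm (V := Space d) ha
  -- A non-integrable function has integral 0 by convention, against the positive Gaussian value.
  rw [integral_undef h] at h1
  have : 0 < (Real.pi / a) ^ ((Module.finrank ℝ (Space d) : ℝ) / 2) := by positivity
  linarith

theorem integrable_exp_neg_mul_sq_norm_add {a : ℝ} (ha : 0 < a) (b : ℝ) :
    Integrable (fun z : Space d => Real.exp (-a * ‖z‖ ^ 2 + b * ‖z‖)) := by
  refine ((integrable_exp_neg_mul_sq_norm (d := d) (half_pos ha)).const_mul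
    (Real.exp (b ^ 2 / (2 * a)))).mono' (by fun_prop) (ae_of_all _ fun z => ?_)
  rw [Real.norm_eq_abs, Real.abs_exp, ← Real.exp_add, Real.exp_le_exp]
  have h : b ^ 2 / (2 * a) + -(a / 2) * ‖z‖ ^ 2 - (-a * ‖z‖ ^ 2 + b * ‖z‖)
      = (a * ‖z‖ - b) ^ 2 / (2 * a) := by
    field_simp
    ring
  have : 0 ≤ (a * ‖z‖ - b) ^ 2 / (2 * a) := by positivity
  linarith

/-- The unnormalized density of the Gibbs measure whose mass defines `viscousPotential`. -/
def gibbsDensity (φ : Space d → ℝ) (ε t : ℝ) (x y : Space d) : ℝ :=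
  Real.exp (-‖x - y‖ ^ 2 / (2 * ε * t) - φ y / ε)

theorem gibbsDensity_pos (φ : Space d → ℝ) (ε t : ℝ) (x y : Space d) :
    0 < gibbsDensity φ ε t x y := Real.exp_pos _

section

variable {φ : Space d → ℝ} {K : ℝ≥0} {ε t : ℝ}

theorem _root_.LipschitzWith.le_add_mul_norm {f : Space d → ℝ} (hf : LipschitzWith K f)
    (x y : Space d) : f x ≤ f y + K * ‖x - y‖ := by
  simpa [dist_eq_norm] using hf.le_add_mul x y

/-- A dominating function uniform over the unit ball about x₀: giving up half of the Gaussian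
exponent, via |x₀ - y|² ≤ 2|x - y|² + 2, pays for moving the centre. -/
theorem gibbsDensity_le (hLip : LipschitzWith K φ) (hε : 0 < ε) (ht : 0 < t)
    {x₀ x : Space d} (hx : ‖x - x₀‖ ≤ 1) (y : Space d) :
    gibbsDensity φ ε t x y ≤ Real.exp (1 / (2 * ε * t) - φ x₀ / ε) *
      Real.exp (-(1 / (4 * ε * t)) * ‖x₀ - y‖ ^ 2 + K / ε * ‖x₀ - y‖) := by
  rw [gibbsDensity, ← Real.exp_add, Real.exp_le_exp]
  have h1 : φ x₀ / ε ≤ φ y / ε + K / ε * ‖x₀ - y‖ := by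
    have := div_le_div_of_nonneg_right (hLip.le_add_mul_norm x₀ y) hε.le
    rwa [add_div, mul_div_right_comm] at this
  have h2 : ‖x₀ - y‖ ^ 2 ≤ 2 * ‖x - y‖ ^ 2 + 2 := by
    have h3 : ‖x₀ - y‖ ≤ ‖x - y‖ + 1 := by
      have : x₀ - y = (x - y) - (x - x₀) := by abel
      rw [this]
      exact (norm_sub_le _ _).trans (by gcongr)
    have h4 := pow_le_pow_left₀ (norm_nonneg _) h3 2
    nlinarith [sq_nonneg (‖x - y‖ - 1)]
  have h5 : -‖x - y‖ ^ 2 / (2 * ε * t) ≤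
      1 / (2 * ε * t) - (1 / (4 * ε * t)) * ‖x₀ - y‖ ^ 2 := by
    have : 1 / (2 * ε * t) - (1 / (4 * ε * t)) * ‖x₀ - y‖ ^ 2 - -‖x - y‖ ^ 2 / (2 * ε * t)
        = (2 * ‖x - y‖ ^ 2 + 2 - ‖x₀ - y‖ ^ 2) / (4 * ε * t) := by
      field_simp
      ring
    have : 0 ≤ (2 * ‖x - y‖ ^ 2 + 2 - ‖x₀ - y‖ ^ 2) / (4 * ε * t) :=
      div_nonneg (by linarith) (by positivity)
    linarith
  linarith

theorem continuous_gibbsDensity (hφ : Continuous φ) (x : Space d) :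
    Continuous (gibbsDensity φ ε t x) := by
  unfold gibbsDensity
  fun_prop

theorem integrable_gibbsDensity (hLip : LipschitzWith K φ) (hε : 0 < ε) (ht : 0 < t)
    (x : Space d) : Integrable (gibbsDensity φ ε t x) := by
  have h : Integrable fun y : Space d => Real.exp (1 / (2 * ε * t) - φ x / ε) *
      Real.exp (-(1 / (4 * ε * t)) * ‖x - y‖ ^ 2 + K / ε * ‖x - y‖) :=
    ((integrable_exp_neg_mul_sq_norm_add (by positivity) _).comp_sub_left x).const_mul _
  refine h.mono' (continuous_gibbsDensity hLip.continuous x).aestronglyMeasurable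
    (ae_of_all _ fun y => ?_)
  rw [Real.norm_eq_abs, abs_of_pos (gibbsDensity_pos ..)]
  exact gibbsDensity_le hLip hε ht (by simp) y

theorem integral_gibbsDensity_pos (hLip : LipschitzWith K φ) (hε : 0 < ε) (ht : 0 < t)
    (x : Space d) : 0 < ∫ y, gibbsDensity φ ε t x y :=
  integral_exp_pos (integrable_gibbsDensity hLip hε ht x)

theorem hasGradientAt_gibbsDensity (hε : 0 < ε) (ht : 0 < t) (x y : Space d) :
    HasGradientAt (fun x => gibbsDensity φ ε t x y)
      (-(gibbsDensity φ ε t x y / (ε * t)) • (x - y)) x := by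
  rw [hasGradientAt_iff_hasFDerivAt]
  have h1 : HasFDerivAt (fun x : Space d => ‖x - y‖ ^ 2) _ x :=
    ((hasFDerivAt_id x).sub_const y).norm_sq
  have h2 := (((h1.neg.mul_const (2 * ε * t)⁻¹).sub_const (φ y / ε))).exp
  simp only [gibbsDensity, div_eq_mul_inv]
  refine h2.congr_fderiv ?_
  ext v
  simp
  field_simp

theorem norm_gradient_gibbsDensity_le (hLip : LipschitzWith K φ) (hε : 0 < ε) (ht : 0 < t)
    {x x' : Space d} (hx : ‖x' - x‖ ≤ 1) (y : Space d) :
    ‖-(gibbsDensity φ ε t x' y / (ε * t)) • (x' - y)‖ ≤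
      Real.exp (1 / (2 * ε * t) - φ x / ε) / (ε * t) *
        Real.exp (-(1 / (4 * ε * t)) * ‖x - y‖ ^ 2 + (K / ε + 1) * ‖x - y‖) := by
  rw [norm_smul, norm_neg, Real.norm_eq_abs,
    abs_of_pos (div_pos (gibbsDensity_pos ..) (by positivity))]
  have h1 : ‖x' - y‖ ≤ Real.exp ‖x - y‖ := by
    have : x' - y = (x - y) + (x' - x) := by abel
    rw [this]
    refine (norm_add_le _ _).trans ((add_le_add_right hx _).trans ?_)
    exact Real.add_one_le_exp _
  calc gibbsDensity φ ε t x' y / (ε * t) * ‖x' - y‖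
      ≤ (Real.exp (1 / (2 * ε * t) - φ x / ε) *
        Real.exp (-(1 / (4 * ε * t)) * ‖x - y‖ ^ 2 + K / ε * ‖x - y‖)) / (ε * t)
        * Real.exp ‖x - y‖ := by
        gcongr
        exact gibbsDensity_le hLip hε ht hx y
    _ = Real.exp (1 / (2 * ε * t) - φ x / ε) / (ε * t) *
        Real.exp (-(1 / (4 * ε * t)) * ‖x - y‖ ^ 2 + (K / ε + 1) * ‖x - y‖) := by
        rw [add_mul, ← add_assoc, Real.exp_add _ (1 * _), one_mul]
        ring

theorem hasGradientAt_integral_gibbsDensity (hLip : LipschitzWith K φ) (hε : 0 < ε) (ht : 0 < t)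
    (x : Space d) :
    HasGradientAt (fun x => ∫ y, gibbsDensity φ ε t x y)
      (∫ y, -(gibbsDensity φ ε t x y / (ε * t)) • (x - y)) x := by
  have hcont := continuous_gibbsDensity (ε := ε) (t := t) hLip.continuous x
  have hbound : Integrable fun y : Space d => Real.exp (1 / (2 * ε * t) - φ x / ε) / (ε * t) *
      Real.exp (-(1 / (4 * ε * t)) * ‖x - y‖ ^ 2 + (K / ε + 1) * ‖x - y‖) :=
    ((integrable_exp_neg_mul_sq_norm_add (by positivity) _).comp_sub_left x).const_mul _
  have hinteg : Integrable fun y => -(gibbsDensity φ ε t x y / (ε * t)) • (x - y) :=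
    hbound.mono' (Continuous.aestronglyMeasurable (by fun_prop))
      (ae_of_all _ fun y => norm_gradient_gibbsDensity_le hLip hε ht (by simp) y)
  rw [hasGradientAt_iff_hasFDerivAt]
  have hdual : InnerProductSpace.toDual ℝ (Space d)
      (∫ y, -(gibbsDensity φ ε t x y / (ε * t)) • (x - y)) =
      ∫ y, InnerProductSpace.toDual ℝ (Space d)
        (-(gibbsDensity φ ε t x y / (ε * t)) • (x - y)) :=
    (ContinuousLinearMap.integral_comp_commSL (σ := starRingEnd ℝ) (by simp)
      (InnerProductSpace.toDual ℝ (Space d)).toLinearIsometry.toContinuousLinearMap hinteg).symm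
  rw [hdual]
  refine hasFDerivAt_integral_of_dominated_of_fderiv_le (𝕜 := ℝ) (s := Metric.ball x 1)
    (F := fun x y => gibbsDensity φ ε t x y)
    (F' := fun x y => InnerProductSpace.toDual ℝ (Space d)
      (-(gibbsDensity φ ε t x y / (ε * t)) • (x - y)))
    (Metric.ball_mem_nhds x one_pos) ?_ (integrable_gibbsDensity hLip hε ht x) ?_ ?_ hbound ?_
  · exact Eventually.of_forall fun x' =>
      (continuous_gibbsDensity hLip.continuous x').aestronglyMeasurable
  · exact Continuous.aestronglyMeasurable (by fun_prop)
  · refine ae_of_all _ fun y x' hx' => ?_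
    have hx1 : ‖x' - x‖ ≤ 1 := by simpa [dist_eq_norm] using (Metric.mem_ball.1 hx').le
    rw [LinearIsometryEquiv.norm_map]
    exact norm_gradient_gibbsDensity_le hLip hε ht hx1 y
  · exact ae_of_all _ fun y x' _ => (hasGradientAt_gibbsDensity hε ht x' y).hasFDerivAt

theorem viscousPotential_eq (φ : Space d → ℝ) (ε t : ℝ) (x : Space d) :
    viscousPotential φ ε t x = -ε * Real.log (1 / (2 * Real.pi * ε * t) ^ ((d : ℝ) / 2) *
      ∫ y, gibbsDensity φ ε t x y) := rfl

/-- Logarithmic form of the Cole-Hopf formula, with the normalization split off. -/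
theorem viscousPotential_eq_add (hLip : LipschitzWith K φ) (hε : 0 < ε) (ht : 0 < t)
    (x : Space d) :
    viscousPotential φ ε t x = ε * ((d : ℝ) / 2) * Real.log (2 * Real.pi * ε * t) -
      ε * Real.log (∫ y, gibbsDensity φ ε t x y) := by
  have hpos : 0 < 2 * Real.pi * ε * t := by positivity
  rw [viscousPotential_eq, Real.log_mul (by positivity)
    (integral_gibbsDensity_pos hLip hε ht x).ne', one_div, Real.log_inv, Real.log_rpow hpos]
  ring

/-- The velocity is (x - y)/t averaged over the Gibbs measure in y. -/
theorem hasGradientAt_viscousPotential (hLip : LipschitzWith K φ) (hε : 0 < ε) (ht : 0 < t)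
    (x : Space d) :
    HasGradientAt (viscousPotential φ ε t)
      ((t * ∫ y, gibbsDensity φ ε t x y)⁻¹ • ∫ y, gibbsDensity φ ε t x y • (x - y)) x := by
  have h1 := (hasGradientAt_integral_gibbsDensity hLip hε ht x).hasFDerivAt
  have hpos := integral_gibbsDensity_pos hLip hε ht x
  have h2 := ((h1.log hpos.ne').const_mul ε).const_sub
    (ε * ((d : ℝ) / 2) * Real.log (2 * Real.pi * ε * t))
  rw [hasGradientAt_iff_hasFDerivAt]
  have h3 : viscousPotential φ ε t = fun x =>
      ε * ((d : ℝ) / 2) * Real.log (2 * Real.pi * ε * t) -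
      ε * Real.log (∫ y, gibbsDensity φ ε t x y) :=
    funext (viscousPotential_eq_add hLip hε ht)
  rw [h3]
  refine h2.congr_fderiv ?_
  have h4 : (∫ y, -(gibbsDensity φ ε t x y / (ε * t)) • (x - y))
      = -(ε * t)⁻¹ • ∫ y, gibbsDensity φ ε t x y • (x - y) := by
    rw [← integral_smul]
    refine integral_congr_ae (ae_of_all _ fun y => ?_)
    simp only [smul_smul]
    congr 1
    ring
  rw [h4]
  ext v
  simp
  field_simp

end

/-! ### Lipschitz bound and semiconcavity of the viscous potential, uniform in ε. -/

section

variable {φ : Space d → ℝ} {K : ℝ≥0} {ε t : ℝ}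

theorem integral_gibbsDensity_eq (φ : Space d → ℝ) (ε t : ℝ) (x : Space d) :
    ∫ y, gibbsDensity φ ε t x y = ∫ z, Real.exp (-‖z‖ ^ 2 / (2 * ε * t) - φ (x - z) / ε) := by
  rw [← integral_sub_left_eq_self _ volume x]
  simp [gibbsDensity]

theorem integrable_exp_translate (hLip : LipschitzWith K φ) (hε : 0 < ε) (ht : 0 < t)
    (x : Space d) :
    Integrable fun z => Real.exp (-‖z‖ ^ 2 / (2 * ε * t) - φ (x - z) / ε) := by
  simpa [gibbsDensity] using (integrable_gibbsDensity hLip hε ht x).comp_sub_left x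

/-- In the variable z = x - y the point x enters only through φ(x - z), so moving it to x' changes
the integrand by a factor of at most exp(K|x - x'|/ε). -/
theorem lipschitzWith_viscousPotential (hLip : LipschitzWith K φ) (hε : 0 < ε) (ht : 0 < t) :
    LipschitzWith K (viscousPotential φ ε t) := by
  refine LipschitzWith.of_le_add_mul K fun x x' => ?_
  rw [viscousPotential_eq_add hLip hε ht, viscousPotential_eq_add hLip hε ht, dist_eq_norm]
  have h1 : Real.exp (-(K * ‖x - x'‖ / ε)) * ∫ y, gibbsDensity φ ε t x' y ≤
      ∫ y, gibbsDensity φ ε t x y := by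
    rw [integral_gibbsDensity_eq, integral_gibbsDensity_eq, ← integral_const_mul]
    refine integral_mono ((integrable_exp_translate hLip hε ht x').const_mul _)
      (integrable_exp_translate hLip hε ht x) fun z => ?_
    simp only
    rw [← Real.exp_add, Real.exp_le_exp]
    have h2 := hLip.le_add_mul_norm (x - z) (x' - z)
    rw [sub_sub_sub_cancel_right] at h2
    have h3 := div_le_div_of_nonneg_right h2 hε.le
    rw [add_div] at h3
    linarith
  have h4 := Real.log_le_log
    (mul_pos (Real.exp_pos _) (integral_gibbsDensity_pos hLip hε ht x')) h1
  rw [Real.log_mul (Real.exp_pos _).ne' (integral_gibbsDensity_pos hLip hε ht x').ne',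
    Real.log_exp] at h4
  have h5 := mul_le_mul_of_nonneg_left h4 hε.le
  have h6 : ε * (-(K * ‖x - x'‖ / ε)) = -(K * ‖x - x'‖) := by field_simp
  rw [mul_add, h6] at h5
  linarith

theorem differentiable_viscousPotential (hLip : LipschitzWith K φ) (hε : 0 < ε) (ht : 0 < t) :
    Differentiable ℝ (viscousPotential φ ε t) := fun x =>
  (hasGradientAt_viscousPotential hLip hε ht x).differentiableAt

theorem norm_gradient_viscousPotential_le (hLip : LipschitzWith K φ) (hε : 0 < ε) (ht : 0 < t)
    (x : Space d) : ‖gradient (viscousPotential φ ε t) x‖ ≤ K := by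
  have h := (differentiable_viscousPotential hLip hε ht x).hasGradientAt.hasFDerivAt.le_of_lipschitz
    (lipschitzWith_viscousPotential hLip hε ht)
  rwa [LinearIsometryEquiv.norm_map] at h

/-- Convexity of `g ↦ log ∫ exp g`. -/
theorem log_integral_exp_le {α : Type*} [MeasurableSpace α] {μ : Measure α} [NeZero μ]
    {g g₁ g₂ : α → ℝ} {a b : ℝ} (ha : 0 ≤ a) (hb : 0 ≤ b) (hab : a + b = 1)
    (hg : ∀ z, g z ≤ a * g₁ z + b * g₂ z)
    (hi : Integrable (fun z => Real.exp (g z)) μ) (hi₁ : Integrable (fun z => Real.exp (g₁ z)) μ)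
    (hi₂ : Integrable (fun z => Real.exp (g₂ z)) μ) :
    Real.log (∫ z, Real.exp (g z) ∂μ) ≤
      a * Real.log (∫ z, Real.exp (g₁ z) ∂μ) + b * Real.log (∫ z, Real.exp (g₂ z) ∂μ) := by
  set I₁ := ∫ z, Real.exp (g₁ z) ∂μ
  set I₂ := ∫ z, Real.exp (g₂ z) ∂μ
  have h₁ : 0 < I₁ := integral_exp_pos hi₁
  have h₂ : 0 < I₂ := integral_exp_pos hi₂
  rw [Real.log_le_iff_le_exp (integral_exp_pos hi)]
  set J := Real.exp (a * Real.log I₁ + b * Real.log I₂) with hJ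
  have hpt : ∀ z, Real.exp (g z) ≤
      J * (a * I₁⁻¹ * Real.exp (g₁ z) + b * I₂⁻¹ * Real.exp (g₂ z)) := by
    intro z
    have hc := convexOn_exp.2 (mem_univ (g₁ z - Real.log I₁)) (mem_univ (g₂ z - Real.log I₂))
      ha hb hab
    simp only [smul_eq_mul, Real.exp_sub, Real.exp_log h₁, Real.exp_log h₂] at hc
    calc Real.exp (g z) ≤ J * Real.exp (a * (g₁ z - Real.log I₁) + b * (g₂ z - Real.log I₂)) := by
          rw [hJ, ← Real.exp_add, Real.exp_le_exp]
          linarith [hg z]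
      _ ≤ J * (a * (Real.exp (g₁ z) / I₁) + b * (Real.exp (g₂ z) / I₂)) := by gcongr
      _ = _ := by ring
  calc ∫ z, Real.exp (g z) ∂μ
      ≤ ∫ z, J * (a * I₁⁻¹ * Real.exp (g₁ z) + b * I₂⁻¹ * Real.exp (g₂ z)) ∂μ :=
        integral_mono hi (((hi₁.const_mul _).add (hi₂.const_mul _)).const_mul J) hpt
    _ = J * (a * I₁⁻¹ * I₁ + b * I₂⁻¹ * I₂) := by
        rw [integral_const_mul, integral_add (hi₁.const_mul _) (hi₂.const_mul _),
          integral_const_mul, integral_const_mul]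
    _ = J := by
        rw [mul_assoc a, mul_assoc b, inv_mul_cancel₀ h₁.ne', inv_mul_cancel₀ h₂.ne', mul_one,
          mul_one, hab, mul_one]

/-- Completing the square in the exponent of the Gibbs density. -/
theorem sq_norm_sub_div_add_eq {t lam : ℝ} (ht : 0 < t) (hlam : 0 ≤ lam) (x z : Space d) :
    ‖x - (z + (1 + lam * t)⁻¹ • x)‖ ^ 2 / (2 * t) + lam / 2 * ‖z + (1 + lam * t)⁻¹ • x‖ ^ 2 =
      (1 + lam * t) / (2 * t) * ‖z‖ ^ 2 + lam / (1 + lam * t) / 2 * ‖x‖ ^ 2 := by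
  have hA : 0 < 1 + lam * t := by positivity
  have h1 : x - (z + (1 + lam * t)⁻¹ • x) = (lam * t / (1 + lam * t)) • x - z := by
    have : lam * t / (1 + lam * t) = 1 - (1 + lam * t)⁻¹ := by field_simp; ring
    rw [this, sub_smul, one_smul]
    abel
  rw [h1, norm_sub_sq_real, norm_add_sq_real, norm_smul, norm_smul, inner_smul_left,
    inner_smul_right, mul_pow, mul_pow, Real.norm_eq_abs, Real.norm_eq_abs, sq_abs, sq_abs,
    real_inner_comm x z]
  simp only [conj_trivial]
  field_simp
  ring

/-- The substitution y = z + x/(1+λt) decouples the quadratic terms. Up to a constant, what remains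
of u - λ_t|x|²/2 is -ε log ∫ exp g(x,z) dz. Here x enters g only through the convex function λ|·|²/2
- φ at z + x/(1+λt), so log-convexity of the integral concludes. -/
theorem lambdaConcave_viscousPotential {lam : ℝ} (hlam : 0 ≤ lam) (hLip : LipschitzWith K φ)
    (hconc : LambdaConcave lam φ) (hε : 0 < ε) (ht : 0 < t) :
    LambdaConcave (lam / (1 + lam * t)) (viscousPotential φ ε t) := by
  have hA : 0 < 1 + lam * t := by positivity
  set A := 1 + lam * t with hAdef
  set g : Space d → Space d → ℝ := fun x z =>
    (-(A / (2 * t) * ‖z‖ ^ 2) - (φ (z + A⁻¹ • x) - lam / 2 * ‖z + A⁻¹ • x‖ ^ 2)) / ε with hg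
  have hgexp : ∀ x z, Real.exp (g x z) = Real.exp (lam / A / 2 * ‖x‖ ^ 2 / ε) *
      gibbsDensity φ ε t x (z + A⁻¹ • x) := by
    intro x z
    rw [gibbsDensity, ← Real.exp_add]
    congr 1
    have h := sq_norm_sub_div_add_eq ht hlam x z
    rw [← hAdef] at h
    have h2 : -‖x - (z + A⁻¹ • x)‖ ^ 2 / (2 * ε * t)
        = -(‖x - (z + A⁻¹ • x)‖ ^ 2 / (2 * t)) / ε := by
      field_simp
    rw [h2, ← add_sub_assoc, ← add_div, ← sub_div]
    simp only [hg]
    congr 1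
    linarith
  have hinteg : ∀ x, Integrable fun z => Real.exp (g x z) := by
    intro x
    simp only [hgexp]
    exact ((integrable_gibbsDensity hLip hε ht x).comp_add_right (A⁻¹ • x)).const_mul _
  have hval : ∀ x, viscousPotential φ ε t x - lam / A / 2 * ‖x‖ ^ 2 =
      ε * ((d : ℝ) / 2) * Real.log (2 * Real.pi * ε * t) -
        ε * Real.log (∫ z, Real.exp (g x z)) := by
    intro x
    simp only [hgexp]
    rw [integral_const_mul, integral_add_right_eq_self (fun z => gibbsDensity φ ε t x z) (A⁻¹ • x),
      Real.log_mul (Real.exp_pos _).ne' (integral_gibbsDensity_pos hLip hε ht x).ne', Real.log_exp,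
      viscousPotential_eq_add hLip hε ht]
    field_simp
    ring
  refine ⟨convex_univ, fun x _ y _ a b ha hb hab => ?_⟩
  simp only [hval, smul_eq_mul]
  have key := log_integral_exp_le (μ := (volume : Measure (Space d))) ha hb hab
    (g := g (a • x + b • y)) (g₁ := g x) (g₂ := g y) ?_ (hinteg _) (hinteg _) (hinteg _)
  · have h2 := mul_le_mul_of_nonneg_left key hε.le
    have h3 : ε * ((d : ℝ) / 2) * Real.log (2 * Real.pi * ε * t) =
      (a + b) * (ε * ((d : ℝ) / 2) * Real.log (2 * Real.pi * ε * t)) := by rw [hab, one_mul]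
    rw [h3]
    nlinarith
  · intro z
    have h4 := hconc.2 (mem_univ (z + A⁻¹ • x)) (mem_univ (z + A⁻¹ • y)) ha hb hab
    have h5 : a • (z + A⁻¹ • x) + b • (z + A⁻¹ • y) = z + A⁻¹ • (a • x + b • y) := by
      have : z = (a + b) • z := by rw [hab, one_smul]
      nth_rewrite 3 [this]
      simp only [smul_add, add_smul, smul_comm A⁻¹]
      abel
    simp only [h5, smul_eq_mul] at h4
    simp only [hg]
    rw [← mul_div_assoc, ← mul_div_assoc, ← add_div]
    refine div_le_div_of_nonneg_right ?_ hε.le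
    have h6 : A / (2 * t) * ‖z‖ ^ 2 = (a + b) * (A / (2 * t) * ‖z‖ ^ 2) := by rw [hab, one_mul]
    linarith

/-- On the segment from x to z, the slope of a concave function over [0,1] is at most its derivative
at 0. -/
theorem LambdaConcave.mem_differential {mu : ℝ} {f : Space d → ℝ} (hf : LambdaConcave mu f)
    {q x : Space d} (hq : HasGradientAt f q x) : q ∈ differential mu f x := by
  intro z
  have hline : HasDerivAt (AffineMap.lineMap x z : ℝ → Space d) (z - x) 0 :=
    AffineMap.hasDerivAt_lineMap
  have hx0 : x = AffineMap.lineMap x z (0 : ℝ) := by simp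
  have h1 : HasFDerivAt (fun y => f y - mu / 2 * ‖y‖ ^ 2) _ x :=
    hq.hasFDerivAt.sub ((hasFDerivAt_id x).norm_sq.const_mul (mu / 2))
  rw [hx0] at h1
  have h2 := h1.comp_hasDerivAt (0 : ℝ) hline
  have h3 : ConcaveOn ℝ univ ((fun y => f y - mu / 2 * ‖y‖ ^ 2) ∘
      (AffineMap.lineMap x z : ℝ → Space d)) := by
    have := hf.comp_affineMap (AffineMap.lineMap x z : ℝ →ᵃ[ℝ] Space d)
    simpa using this
  have h4 := h3.slope_le_of_hasDerivAt (mem_univ 0) (mem_univ 1) one_pos h2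
  simp only [slope_def_field, Function.comp_apply, AffineMap.lineMap_apply_one,
    AffineMap.lineMap_apply_zero, sub_zero, div_one, _root_.sub_apply,
    InnerProductSpace.toDual_apply_apply, _root_.smul_apply,
    ContinuousLinearMap.comp_apply, ContinuousLinearMap.id_apply, innerSL_apply_apply, id,
    smul_eq_mul, nsmul_eq_mul, inner_sub_right, real_inner_self_eq_norm_sq] at h4
  rw [norm_sub_sq_real, inner_sub_right, real_inner_comm x z]
  push_cast at h4
  linarith

theorem gradient_viscousPotential_mem_differential {lam : ℝ} (hlam : 0 ≤ lam)
    (hLip : LipschitzWith K φ) (hconc : LambdaConcave lam φ) (hε : 0 < ε) (ht : 0 < t)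
    (x : Space d) : gradient (viscousPotential φ ε t) x ∈
      differential (lam / (1 + lam * t)) (viscousPotential φ ε t) x :=
  (lambdaConcave_viscousPotential hlam hLip hconc hε ht).mem_differential
    (differentiable_viscousPotential hLip hε ht x).hasGradientAt

end

/-! ### The viscous velocity field in the time variable s = √t. -/

/-- The Gibbs density in the variable `ζ = (x - y) / s`, where `s = √t`, normalized so as to stay
bounded away from zero and infinity in `x`. -/
def scaledDensity (φ : Space d → ℝ) (ε s : ℝ) (x ζ : Space d) : ℝ :=
  Real.exp (-‖ζ‖ ^ 2 / (2 * ε) + (φ x - φ (x - s • ζ)) / ε)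

/-- The mean of the probability measure with density proportional to `scaledDensity`. -/
def scaledMean (φ : Space d → ℝ) (ε s : ℝ) (x : Space d) : Space d :=
  (∫ ζ, scaledDensity φ ε s x ζ)⁻¹ • ∫ ζ, scaledDensity φ ε s x ζ • ζ

section

variable {φ : Space d → ℝ} {K : ℝ≥0} {ε : ℝ}

theorem gibbsDensity_scale (φ : Space d → ℝ) {s : ℝ} (hε : 0 < ε) (hs : 0 < s)
    (x ζ : Space d) : gibbsDensity φ ε (s ^ 2) x (x - s • ζ) =
      Real.exp (-φ x / ε) * scaledDensity φ ε s x ζ := by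
  rw [gibbsDensity, scaledDensity, ← Real.exp_add, sub_sub_cancel, norm_smul, mul_pow,
    Real.norm_eq_abs, sq_abs]
  congr 1
  field_simp
  ring

/-- The velocity is singular only through the factor 1/s. Since dt = 2s ds, the equation in time s
reads dx/ds = 2 `scaledMean`. -/
theorem gradient_viscousPotential_eq (hLip : LipschitzWith K φ) (hε : 0 < ε) {s : ℝ} (hs : 0 < s)
    (x : Space d) :
    gradient (viscousPotential φ ε (s ^ 2)) x = s⁻¹ • scaledMean φ ε s x := by
  rw [(hasGradientAt_viscousPotential hLip hε (pow_pos hs 2) x).gradient]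
  have hcv : ∀ {E : Type} [NormedAddCommGroup E] [NormedSpace ℝ E] (f : Space d → E),
      ∫ y, f y = s ^ d • ∫ ζ, f (x - s • ζ) := by
    intro E _ _ f
    rw [Measure.integral_comp_smul volume (fun z => f (x - z)) s,
      integral_sub_left_eq_self f volume x, smul_smul, finrank_euclideanSpace, Fintype.card_fin,
      abs_of_pos (by positivity), mul_inv_cancel₀ (by positivity), one_smul]
  rw [hcv, hcv (fun y => gibbsDensity φ ε (s ^ 2) x y • (x - y))]
  simp only [gibbsDensity_scale φ hε hs, sub_sub_cancel]
  have h2 : ∀ ζ : Space d, (Real.exp (-φ x / ε) * scaledDensity φ ε s x ζ) • s • ζ =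
      (Real.exp (-φ x / ε) * s) • scaledDensity φ ε s x ζ • ζ := by
    intro ζ
    simp only [smul_smul]
    congr 1
    ring
  simp only [h2]
  rw [integral_const_mul, integral_smul, scaledMean]
  simp only [smul_smul, smul_eq_mul]
  congr 1
  have := Real.exp_pos (-φ x / ε)
  field_simp

theorem abs_exp_sub_exp_le {a b M : ℝ} (ha : a ≤ M) (hb : b ≤ M) :
    |Real.exp a - Real.exp b| ≤ |a - b| * Real.exp M := by
  have key : ∀ {a b : ℝ}, a ≤ M → b ≤ a → Real.exp a - Real.exp b ≤ (a - b) * Real.exp M := by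
    intro a b ha hba
    have h1 := Real.add_one_le_exp (b - a)
    have h2 : Real.exp b = Real.exp (b - a) * Real.exp a := by rw [← Real.exp_add]; ring_nf
    have h3 := Real.exp_le_exp.2 ha
    have h4 := Real.exp_pos a
    nlinarith
  rcases le_total b a with h | h
  · rw [abs_of_nonneg (sub_nonneg.2 (Real.exp_le_exp.2 h)), abs_of_nonneg (sub_nonneg.2 h)]
    exact key ha h
  · rw [abs_sub_comm, abs_sub_comm a, abs_of_nonneg (sub_nonneg.2 (Real.exp_le_exp.2 h)),
      abs_of_nonneg (sub_nonneg.2 h)]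
    exact key hb h

theorem abs_div_sub_comp_le (hLip : LipschitzWith K φ) (hε : 0 < ε) {s S : ℝ}
    (hs : s ∈ Icc 0 S) (x ζ : Space d) :
    |(φ x - φ (x - s • ζ)) / ε| ≤ K * S / ε * ‖ζ‖ := by
  have h := hLip.dist_le_mul x (x - s • ζ)
  rw [Real.dist_eq, dist_eq_norm, sub_sub_cancel, norm_smul, Real.norm_eq_abs,
    abs_of_nonneg hs.1] at h
  rw [abs_div, abs_of_pos hε, div_mul_eq_mul_div]
  refine div_le_div_of_nonneg_right (h.trans ?_) hε.le
  rw [mul_assoc]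
  gcongr
  exact hs.2

theorem scaledDensity_le (hLip : LipschitzWith K φ) (hε : 0 < ε) {s S : ℝ}
    (hs : s ∈ Icc 0 S) (x ζ : Space d) :
    scaledDensity φ ε s x ζ ≤ Real.exp (-(1 / (2 * ε)) * ‖ζ‖ ^ 2 + K * S / ε * ‖ζ‖) := by
  rw [scaledDensity, Real.exp_le_exp]
  have := (abs_le.1 (abs_div_sub_comp_le hLip hε hs x ζ)).2
  have h : -‖ζ‖ ^ 2 / (2 * ε) = -(1 / (2 * ε)) * ‖ζ‖ ^ 2 := by ring
  linarith

theorem le_scaledDensity (hLip : LipschitzWith K φ) (hε : 0 < ε) {s S : ℝ}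
    (hs : s ∈ Icc 0 S) (x ζ : Space d) :
    Real.exp (-(1 / (2 * ε)) * ‖ζ‖ ^ 2 + -(K * S / ε) * ‖ζ‖) ≤ scaledDensity φ ε s x ζ := by
  rw [scaledDensity, Real.exp_le_exp]
  have := (abs_le.1 (abs_div_sub_comp_le hLip hε hs x ζ)).1
  have h : -‖ζ‖ ^ 2 / (2 * ε) = -(1 / (2 * ε)) * ‖ζ‖ ^ 2 := by ring
  linarith

/-- Subtracting φ at x in the exponent makes this bound uniform in x although φ may be unbounded.
The linear growth in ζ is absorbed into exp ‖ζ‖, hence the `+ 1`. -/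
theorem abs_scaledDensity_sub_le (hLip : LipschitzWith K φ) (hε : 0 < ε) {s s' S : ℝ}
    (hs : s ∈ Icc 0 S) (hs' : s' ∈ Icc 0 S) (x x' ζ : Space d) :
    |scaledDensity φ ε s x ζ - scaledDensity φ ε s' x' ζ| ≤
      2 * K / ε * (‖x - x'‖ + |s - s'|) *
        Real.exp (-(1 / (2 * ε)) * ‖ζ‖ ^ 2 + (K * S / ε + 1) * ‖ζ‖) := by
  have e1 := (abs_le.1 (abs_div_sub_comp_le hLip hε hs x ζ)).2
  have e2 := (abs_le.1 (abs_div_sub_comp_le hLip hε hs' x' ζ)).2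
  have h := abs_exp_sub_exp_le
    (a := -‖ζ‖ ^ 2 / (2 * ε) + (φ x - φ (x - s • ζ)) / ε)
    (b := -‖ζ‖ ^ 2 / (2 * ε) + (φ x' - φ (x' - s' • ζ)) / ε)
    (M := -‖ζ‖ ^ 2 / (2 * ε) + K * S / ε * ‖ζ‖) (by linarith) (by linarith)
  refine h.trans ?_
  have h1 : |-‖ζ‖ ^ 2 / (2 * ε) + (φ x - φ (x - s • ζ)) / ε -
      (-‖ζ‖ ^ 2 / (2 * ε) + (φ x' - φ (x' - s' • ζ)) / ε)| ≤
      2 * K / ε * (‖x - x'‖ + |s - s'|) * Real.exp ‖ζ‖ := by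
    have e : -‖ζ‖ ^ 2 / (2 * ε) + (φ x - φ (x - s • ζ)) / ε -
      (-‖ζ‖ ^ 2 / (2 * ε) + (φ x' - φ (x' - s' • ζ)) / ε) =
      ((φ x - φ x') - (φ (x - s • ζ) - φ (x' - s' • ζ))) / ε := by ring
    have a1 : |φ x - φ x'| ≤ K * ‖x - x'‖ := by
      simpa [Real.dist_eq, dist_eq_norm] using hLip.dist_le_mul x x'
    have a2 : |φ (x - s • ζ) - φ (x' - s' • ζ)| ≤ K * (‖x - x'‖ + |s - s'| * ‖ζ‖) := by
      have := hLip.dist_le_mul (x - s • ζ) (x' - s' • ζ)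
      rw [Real.dist_eq, dist_eq_norm] at this
      refine this.trans ?_
      gcongr
      have e3 : x - s • ζ - (x' - s' • ζ) = (x - x') - (s - s') • ζ := by
        rw [sub_smul]; abel
      rw [e3]
      refine (norm_sub_le _ _).trans ?_
      rw [norm_smul, Real.norm_eq_abs]
    have a3 : ‖ζ‖ + 1 ≤ Real.exp ‖ζ‖ := Real.add_one_le_exp _
    rw [e, abs_div, abs_of_pos hε, mul_assoc, div_mul_eq_mul_div]
    refine div_le_div_of_nonneg_right ((abs_sub _ _).trans ((add_le_add a1 a2).trans ?_)) hε.le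
    have b1 : ‖x - x'‖ + (‖x - x'‖ + |s - s'| * ‖ζ‖) ≤
        2 * ((‖x - x'‖ + |s - s'|) * Real.exp ‖ζ‖) := by
      have c1 := norm_nonneg (x - x')
      have c2 := abs_nonneg (s - s')
      have c3 := norm_nonneg ζ
      have d1 : (‖x - x'‖ + |s - s'|) * (‖ζ‖ + 1) ≤ (‖x - x'‖ + |s - s'|) * Real.exp ‖ζ‖ := by
        gcongr
      nlinarith [mul_nonneg c1 c3, mul_nonneg c2 c3]
    have := mul_le_mul_of_nonneg_left b1 K.coe_nonneg
    linarith
  refine (mul_le_mul_of_nonneg_right h1 (Real.exp_pos _).le).trans (le_of_eq ?_)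
  rw [mul_assoc, ← Real.exp_add]
  congr 2
  ring

theorem continuous_scaledDensity (hφ : Continuous φ) (s : ℝ) (x : Space d) :
    Continuous (scaledDensity φ ε s x) := by
  unfold scaledDensity
  fun_prop

theorem integrable_scaledDensity (hLip : LipschitzWith K φ) (hε : 0 < ε) {s S : ℝ}
    (hs : s ∈ Icc 0 S) (x : Space d) : Integrable (scaledDensity φ ε s x) := by
  refine (integrable_exp_neg_mul_sq_norm_add (a := 1 / (2 * ε)) (by positivity) (K * S / ε)).mono'
    (continuous_scaledDensity hLip.continuous s x).aestronglyMeasurable (ae_of_all _ fun ζ => ?_)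
  rw [Real.norm_eq_abs, scaledDensity, Real.abs_exp]
  exact scaledDensity_le hLip hε hs x ζ

/-- Dominating function for the first moment of `scaledDensity`. -/
theorem exp_mul_norm_le (a b : ℝ) (ζ : Space d) :
    Real.exp (-a * ‖ζ‖ ^ 2 + b * ‖ζ‖) * ‖ζ‖ ≤ Real.exp (-a * ‖ζ‖ ^ 2 + (b + 1) * ‖ζ‖) := by
  have : ‖ζ‖ ≤ Real.exp ‖ζ‖ := by linarith [Real.add_one_le_exp ‖ζ‖]
  calc _ ≤ Real.exp (-a * ‖ζ‖ ^ 2 + b * ‖ζ‖) * Real.exp ‖ζ‖ := by gcongr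
    _ = _ := by rw [← Real.exp_add]; congr 1; ring

theorem norm_scaledDensity_smul_le (hLip : LipschitzWith K φ) (hε : 0 < ε) {s S : ℝ}
    (hs : s ∈ Icc 0 S) (x ζ : Space d) :
    ‖scaledDensity φ ε s x ζ • ζ‖ ≤
      Real.exp (-(1 / (2 * ε)) * ‖ζ‖ ^ 2 + (K * S / ε + 1) * ‖ζ‖) := by
  rw [norm_smul, Real.norm_eq_abs,
    abs_of_pos (show 0 < scaledDensity φ ε s x ζ from Real.exp_pos _)]
  exact (mul_le_mul_of_nonneg_right (scaledDensity_le hLip hε hs x ζ) (norm_nonneg _)).trans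
    (exp_mul_norm_le _ _ _)

theorem integrable_scaledDensity_smul (hLip : LipschitzWith K φ) (hε : 0 < ε) {s S : ℝ}
    (hs : s ∈ Icc 0 S) (x : Space d) : Integrable fun ζ => scaledDensity φ ε s x ζ • ζ := by
  refine (integrable_exp_neg_mul_sq_norm_add (a := 1 / (2 * ε)) (by positivity)
    (K * S / ε + 1)).mono' ?_ (ae_of_all _ (norm_scaledDensity_smul_le hLip hε hs x))
  have := continuous_scaledDensity (ε := ε) hLip.continuous s x
  exact Continuous.aestronglyMeasurable (by fun_prop)

/-- A quotient of bounded Lipschitz integrals whose denominator stays above a Gaussian integral `m`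
> 0. Both bounds include s = 0, which is what Picard–Lindelöf needs. -/
theorem exists_bounds_scaledMean (hLip : LipschitzWith K φ) (hε : 0 < ε) (S : ℝ) :
    ∃ M C : ℝ≥0, (∀ s ∈ Icc 0 S, ∀ x, ‖scaledMean φ ε s x‖ ≤ M) ∧
      ∀ s ∈ Icc 0 S, ∀ s' ∈ Icc 0 S, ∀ x x',
        ‖scaledMean φ ε s x - scaledMean φ ε s' x'‖ ≤ C * (‖x - x'‖ + |s - s'|) := by
  have hinteg : ∀ b : ℝ, Integrable fun ζ : Space d =>
      Real.exp (-(1 / (2 * ε)) * ‖ζ‖ ^ 2 + b * ‖ζ‖) :=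
    integrable_exp_neg_mul_sq_norm_add (by positivity)
  set m := ∫ ζ : Space d, Real.exp (-(1 / (2 * ε)) * ‖ζ‖ ^ 2 + -(K * S / ε) * ‖ζ‖) with hm
  set E₁ := ∫ ζ : Space d, Real.exp (-(1 / (2 * ε)) * ‖ζ‖ ^ 2 + (K * S / ε + 1) * ‖ζ‖) with hE₁
  set E₂ := ∫ ζ : Space d, Real.exp (-(1 / (2 * ε)) * ‖ζ‖ ^ 2 + (K * S / ε + 1 + 1) * ‖ζ‖) with hE₂
  have hmpos : 0 < m := integral_exp_pos (hinteg _)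
  have hE₁pos : 0 < E₁ := integral_exp_pos (hinteg _)
  have hE₂pos : 0 < E₂ := integral_exp_pos (hinteg _)
  have hD : ∀ s ∈ Icc 0 S, ∀ x, m ≤ ∫ ζ, scaledDensity φ ε s x ζ := fun s hs x =>
    integral_mono (hinteg _) (integrable_scaledDensity hLip hε hs x) (le_scaledDensity hLip hε hs x)
  have hN : ∀ s ∈ Icc 0 S, ∀ x, ‖∫ ζ, scaledDensity φ ε s x ζ • ζ‖ ≤ E₁ := fun s hs x =>
    norm_integral_le_of_norm_le (hinteg _) (ae_of_all _ (norm_scaledDensity_smul_le hLip hε hs x))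
  have hDD : ∀ s ∈ Icc 0 S, ∀ s' ∈ Icc 0 S, ∀ x x',
      |(∫ ζ, scaledDensity φ ε s x ζ) - ∫ ζ, scaledDensity φ ε s' x' ζ| ≤
        2 * K / ε * (‖x - x'‖ + |s - s'|) * E₁ := by
    intro s hs s' hs' x x'
    rw [← integral_sub (integrable_scaledDensity hLip hε hs x)
      (integrable_scaledDensity hLip hε hs' x'), ← integral_const_mul, ← Real.norm_eq_abs]
    refine norm_integral_le_of_norm_le ((hinteg _).const_mul _) (ae_of_all _ fun ζ => ?_)
    exact abs_scaledDensity_sub_le hLip hε hs hs' x x' ζ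
  have hNN : ∀ s ∈ Icc 0 S, ∀ s' ∈ Icc 0 S, ∀ x x',
      ‖(∫ ζ, scaledDensity φ ε s x ζ • ζ) - ∫ ζ, scaledDensity φ ε s' x' ζ • ζ‖ ≤
        2 * K / ε * (‖x - x'‖ + |s - s'|) * E₂ := by
    intro s hs s' hs' x x'
    rw [← integral_sub (integrable_scaledDensity_smul hLip hε hs x)
      (integrable_scaledDensity_smul hLip hε hs' x'), ← integral_const_mul]
    refine norm_integral_le_of_norm_le ((hinteg _).const_mul _) (ae_of_all _ fun ζ => ?_)
    rw [← sub_smul, norm_smul, Real.norm_eq_abs]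
    refine (mul_le_mul_of_nonneg_right (abs_scaledDensity_sub_le hLip hε hs hs' x x' ζ)
      (norm_nonneg _)).trans ?_
    rw [mul_assoc]
    gcongr
    exact exp_mul_norm_le _ _ _
  refine ⟨⟨m⁻¹ * E₁, by positivity⟩,
    ⟨m⁻¹ * (2 * K / ε * E₂) + m⁻¹ * m⁻¹ * (2 * K / ε * E₁) * E₁, by positivity⟩, ?_, ?_⟩
  · intro s hs x
    have h0 := hmpos.trans_le (hD s hs x)
    rw [scaledMean, norm_smul, norm_inv, Real.norm_eq_abs, abs_of_pos h0]
    show _ ≤ m⁻¹ * E₁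
    gcongr
    · exact hD s hs x
    · exact hN s hs x
  · intro s hs s' hs' x x'
    have h0 := hmpos.trans_le (hD s hs x)
    have h0' := hmpos.trans_le (hD s' hs' x')
    have b1 := hD s hs x
    have b2 := hD s' hs' x'
    have b3 := hN s' hs' x'
    have b4 := hDD s' hs' s hs x' x
    have b5 := hNN s hs s' hs' x x'
    rw [norm_sub_rev x', abs_sub_comm s'] at b4
    rw [scaledMean, scaledMean]
    generalize (∫ ζ, scaledDensity φ ε s x ζ) = D at *
    generalize (∫ ζ, scaledDensity φ ε s' x' ζ) = D' at *
    generalize (∫ ζ, scaledDensity φ ε s x ζ • ζ) = N at *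
    generalize (∫ ζ, scaledDensity φ ε s' x' ζ • ζ) = N' at *
    generalize hδ : ‖x - x'‖ + |s - s'| = δ at *
    have hδ0 : 0 ≤ δ := by rw [← hδ]; positivity
    have e1 : D⁻¹ • N - D'⁻¹ • N' = D⁻¹ • (N - N') + (D⁻¹ * D'⁻¹ * (D' - D)) • N' := by
      have : D⁻¹ * D'⁻¹ * (D' - D) = D⁻¹ - D'⁻¹ := by field_simp
      rw [this, smul_sub, sub_smul]
      abel
    rw [e1]
    refine (norm_add_le _ _).trans ?_
    rw [norm_smul, norm_smul, norm_mul, norm_mul, norm_inv, norm_inv, Real.norm_eq_abs,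
      Real.norm_eq_abs, Real.norm_eq_abs, abs_of_pos h0, abs_of_pos h0']
    calc D⁻¹ * ‖N - N'‖ + D⁻¹ * D'⁻¹ * |D' - D| * ‖N'‖
        ≤ m⁻¹ * (2 * K / ε * δ * E₂) + m⁻¹ * m⁻¹ * (2 * K / ε * δ * E₁) * E₁ := by gcongr
      _ = (m⁻¹ * (2 * K / ε * E₂) + m⁻¹ * m⁻¹ * (2 * K / ε * E₁) * E₁) * δ := by ring

end

/-! ### The Hopf–Lax potential and uniform convergence to it. -/

section

variable {φ : Space d → ℝ} {K : ℝ≥0} {ε t : ℝ}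

theorem bddBelow_hopfLax (hLip : LipschitzWith K φ) (ht : 0 < t) (x : Space d) :
    BddBelow (range fun y : Space d => ‖x - y‖ ^ 2 / (2 * t) + φ y) := by
  refine ⟨φ x - K ^ 2 * t / 2, ?_⟩
  rintro _ ⟨y, rfl⟩
  have h1 := hLip.le_add_mul_norm x y
  have h2 : ‖x - y‖ ^ 2 / (2 * t) - K * ‖x - y‖ + K ^ 2 * t / 2 =
      (‖x - y‖ - K * t) ^ 2 / (2 * t) := by
    field_simp
    ring
  have h3 : 0 ≤ (‖x - y‖ - K * t) ^ 2 / (2 * t) := by positivity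
  simp only
  linarith

theorem hopfLax_le (hLip : LipschitzWith K φ) (ht : 0 < t) (x y : Space d) :
    hopfLax φ t x ≤ ‖x - y‖ ^ 2 / (2 * t) + φ y :=
  ciInf_le (bddBelow_hopfLax hLip ht x) y

theorem le_hopfLax {x : Space d} {c : ℝ} (h : ∀ y, c ≤ ‖x - y‖ ^ 2 / (2 * t) + φ y) :
    c ≤ hopfLax φ t x :=
  le_ciInf h

theorem lipschitzWith_hopfLax (hLip : LipschitzWith K φ) (ht : 0 < t) :
    LipschitzWith K (hopfLax φ t) := by
  refine LipschitzWith.of_le_add_mul K fun x x' => ?_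
  rw [← sub_le_iff_le_add, dist_eq_norm]
  refine le_hopfLax fun y => ?_
  have h1 := hopfLax_le hLip ht x (y + (x - x'))
  have h2 := hLip.le_add_mul_norm (y + (x - x')) y
  have h3 : x - (y + (x - x')) = x' - y := by abel
  rw [h3] at h1
  rw [add_sub_cancel_left] at h2
  linarith

theorem hopfLax_anti (hLip : LipschitzWith K φ) {s : ℝ} (hs : 0 < s) (hst : s ≤ t) (x : Space d) :
    hopfLax φ t x ≤ hopfLax φ s x := by
  refine le_hopfLax fun y => (hopfLax_le hLip (hs.trans_le hst) x y).trans ?_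
  gcongr

theorem hopfLax_le_add (hLip : LipschitzWith K φ) {s : ℝ} (hs : 0 < s) (hst : s ≤ t)
    (x : Space d) : hopfLax φ s x ≤ hopfLax φ t x + K ^ 2 / 2 * (t - s) := by
  have ht : 0 < t := hs.trans_le hst
  rw [← sub_le_iff_le_add]
  refine le_hopfLax fun y => ?_
  -- The trial point is where the straight path from x to y, traversed in time t, stands after time
  -- s. With the Lipschitz bound on φ the deficit is a perfect square.
  have h1 := hopfLax_le hLip hs x (x - (s / t) • (x - y))
  have h2 := hLip.le_add_mul_norm (x - (s / t) • (x - y)) y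
  have h3 : x - (s / t) • (x - y) - y = (1 - s / t) • (x - y) := by
    rw [sub_smul, one_smul]; abel
  have h4 : 0 ≤ 1 - s / t := by rw [sub_nonneg, div_le_one ht]; exact hst
  rw [h3, norm_smul, Real.norm_eq_abs, abs_of_nonneg h4] at h2
  rw [sub_sub_cancel, norm_smul, Real.norm_eq_abs, abs_of_pos (by positivity)] at h1
  have h5 : ‖x - y‖ ^ 2 / (2 * t) - (s / t * ‖x - y‖) ^ 2 / (2 * s) -
      K * ((1 - s / t) * ‖x - y‖) + K ^ 2 / 2 * (t - s) =
      (t - s) * (‖x - y‖ / t - K) ^ 2 / 2 := by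
    field_simp
    ring
  have h6 : 0 ≤ (t - s) * (‖x - y‖ / t - K) ^ 2 / 2 := by
    have := sub_nonneg.2 hst
    positivity
  linarith

theorem abs_hopfLax_sub_le (hLip : LipschitzWith K φ) {s : ℝ} (hs : 0 < s) (ht : 0 < t)
    (x y : Space d) :
    |hopfLax φ s x - hopfLax φ t y| ≤ K * ‖x - y‖ + K ^ 2 / 2 * |s - t| := by
  have h1 : |hopfLax φ s x - hopfLax φ s y| ≤ K * ‖x - y‖ := by
    simpa [Real.dist_eq, dist_eq_norm] using (lipschitzWith_hopfLax hLip hs).dist_le_mul x y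
  have h2 : |hopfLax φ s y - hopfLax φ t y| ≤ K ^ 2 / 2 * |s - t| := by
    rcases le_total s t with h | h
    · have a := hopfLax_anti hLip hs h y
      have b := hopfLax_le_add hLip hs h y
      rw [abs_of_nonneg (by linarith), abs_sub_comm, abs_of_nonneg (sub_nonneg.2 h)]
      linarith
    · have a := hopfLax_anti hLip ht h y
      have b := hopfLax_le_add hLip ht h y
      rw [abs_sub_comm, abs_of_nonneg (by linarith), abs_of_nonneg (sub_nonneg.2 h)]
      linarith
  exact (abs_sub_le _ (hopfLax φ s y) _).trans (add_le_add h1 h2)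

/-- Averaging over w and -w turns the linear factor into a hyperbolic cosine, which is at least 1.
-/
theorem le_integral_exp_neg_mul_sq_norm_add_inner {b : ℝ} (hb : 0 < b) (c : Space d) :
    (Real.pi / b) ^ ((d : ℝ) / 2) ≤ ∫ w : Space d, Real.exp (-b * ‖w‖ ^ 2 + inner ℝ c w) := by
  have hinteg : ∀ c : Space d, Integrable fun w => Real.exp (-b * ‖w‖ ^ 2 + inner ℝ c w) := by
    intro c
    refine (integrable_exp_neg_mul_sq_norm_add hb ‖c‖).mono' (by fun_prop) (ae_of_all _ fun w => ?_)
    rw [Real.norm_eq_abs, Real.abs_exp, Real.exp_le_exp]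
    linarith [real_inner_le_norm c w]
  have h1 : ∫ w : Space d, Real.exp (-b * ‖w‖ ^ 2 + inner ℝ c w) =
      ∫ w : Space d, Real.exp (-b * ‖w‖ ^ 2 + inner ℝ (-c) w) := by
    rw [← integral_neg_eq_self]
    simp
  have h2 : 2 * ∫ w : Space d, Real.exp (-b * ‖w‖ ^ 2) ≤
      2 * ∫ w : Space d, Real.exp (-b * ‖w‖ ^ 2 + inner ℝ c w) := by
    rw [two_mul (∫ w : Space d, Real.exp (-b * ‖w‖ ^ 2 + inner ℝ c w))]
    nth_rewrite 2 [h1]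
    rw [← integral_add (hinteg _) (hinteg _), ← integral_const_mul]
    refine integral_mono ((integrable_exp_neg_mul_sq_norm hb).const_mul _)
      ((hinteg _).add (hinteg _)) fun w => ?_
    simp only [inner_neg_left, Real.exp_add, ← mul_add, mul_comm (2 : ℝ)]
    gcongr
    have := Real.add_one_le_exp (inner ℝ c w)
    have := Real.add_one_le_exp (-inner ℝ c w)
    linarith
  have h3 := GaussianFourier.integral_rexp_neg_mul_sq_norm (V := Space d) hb
  rw [finrank_euclideanSpace, Fintype.card_fin] at h3
  linarith

/-- For each trial point y, the Gibbs integral is bounded below by a Gaussian centred there, with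
φ(y + w) replaced by φ(y) + K|w| and K|w| ≤ |w|²/(2ε) + K²ε/2. The constant `b` is 1/(2εt) +
1/(2ε²). -/
theorem viscousPotential_le (hLip : LipschitzWith K φ) (hε : 0 < ε) (ht : 0 < t) (x : Space d) :
    viscousPotential φ ε t x ≤ hopfLax φ t x +
      (ε * K ^ 2 / 2 + ε * ((d : ℝ) / 2) * (Real.log (ε + t) - Real.log ε)) := by
  rw [← sub_le_iff_le_add]
  refine le_hopfLax fun y => ?_
  set F := ‖x - y‖ ^ 2 / (2 * t) + φ y with hF
  have hb : 0 < (ε + t) / (2 * ε ^ 2 * t) := by positivity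
  set b := (ε + t) / (2 * ε ^ 2 * t) with hbdef
  set c : Space d := (ε * t)⁻¹ • (x - y) with hc
  have hpt : ∀ w : Space d, Real.exp (-F / ε - K ^ 2 / 2) *
      Real.exp (-b * ‖w‖ ^ 2 + inner ℝ c w) ≤ gibbsDensity φ ε t x (w + y) := by
    intro w
    rw [gibbsDensity, ← Real.exp_add, Real.exp_le_exp]
    have h1 : φ (w + y) ≤ φ y + K * ‖w‖ := by simpa using hLip.le_add_mul_norm (w + y) y
    have h2 : K * ‖w‖ ≤ ‖w‖ ^ 2 / (2 * ε) + K ^ 2 * ε / 2 := by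
      have : ‖w‖ ^ 2 / (2 * ε) + K ^ 2 * ε / 2 - K * ‖w‖ = (‖w‖ - K * ε) ^ 2 / (2 * ε) := by
        field_simp
        ring
      have : 0 ≤ (‖w‖ - K * ε) ^ 2 / (2 * ε) := by positivity
      linarith
    have h3 : φ (w + y) / ε ≤ (φ y + (‖w‖ ^ 2 / (2 * ε) + K ^ 2 * ε / 2)) / ε :=
      div_le_div_of_nonneg_right (by linarith) hε.le
    have h4 : x - (w + y) = (x - y) - w := by abel
    have h5 : -F / ε - K ^ 2 / 2 + (-b * ‖w‖ ^ 2 + inner ℝ c w) =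
        -‖x - (w + y)‖ ^ 2 / (2 * ε * t) -
          (φ y + (‖w‖ ^ 2 / (2 * ε) + K ^ 2 * ε / 2)) / ε := by
      rw [h4, norm_sub_sq_real (x - y) w, hc, inner_smul_left, hF, hbdef]
      simp only [conj_trivial]
      field_simp
      ring
    linarith
  have hci : Integrable fun w : Space d => Real.exp (-b * ‖w‖ ^ 2 + inner ℝ c w) := by
    refine (integrable_exp_neg_mul_sq_norm_add hb ‖c‖).mono' (by fun_prop) (ae_of_all _ fun w => ?_)
    rw [Real.norm_eq_abs, Real.abs_exp, Real.exp_le_exp]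
    linarith [real_inner_le_norm c w]
  have hW : Real.exp (-F / ε - K ^ 2 / 2) * (Real.pi / b) ^ ((d : ℝ) / 2) ≤
      ∫ z, gibbsDensity φ ε t x z := by
    calc _ ≤ Real.exp (-F / ε - K ^ 2 / 2) *
          ∫ w : Space d, Real.exp (-b * ‖w‖ ^ 2 + inner ℝ c w) := by
          gcongr
          exact le_integral_exp_neg_mul_sq_norm_add_inner hb c
      _ ≤ ∫ w, gibbsDensity φ ε t x (w + y) := by
          rw [← integral_const_mul]
          exact integral_mono (hci.const_mul _)
            ((integrable_gibbsDensity hLip hε ht x).comp_add_right y) hpt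
      _ = _ := integral_add_right_eq_self _ y
  have hlog := Real.log_le_log (by positivity) hW
  rw [Real.log_mul (by positivity) (by positivity), Real.log_exp, Real.log_rpow (by positivity)]
    at hlog
  have hlogb : Real.log (2 * Real.pi * ε * t) - Real.log (Real.pi / b) =
      Real.log (ε + t) - Real.log ε := by
    rw [← Real.log_div (by positivity) (by positivity), ← Real.log_div (by positivity) hε.ne',
      hbdef]
    congr 1
    field_simp
  rw [viscousPotential_eq_add hLip hε ht, ← hlogb]
  have h6 := mul_le_mul_of_nonneg_left hlog hε.le
  have h7 : ε * (-F / ε - K ^ 2 / 2 + (d : ℝ) / 2 * Real.log (Real.pi / b)) =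
      -F - ε * K ^ 2 / 2 + ε * ((d : ℝ) / 2) * Real.log (Real.pi / b) := by
    field_simp
  rw [h7] at h6
  linarith

/-- A fraction ε of the quadratic cost is set aside: divided by ε it leaves a Gaussian independent
of ε, which keeps the integral finite. The rest is the Hopf–Lax cost at the later time t/(1-ε), and
Lipschitz dependence on time makes the shift cost at most K²tε. -/
theorem le_viscousPotential (hLip : LipschitzWith K φ) (hε : 0 < ε) (hε2 : ε ≤ 1 / 2) (ht : 0 < t)
    (x : Space d) :
    hopfLax φ t x - (K ^ 2 * t * ε - ε * ((d : ℝ) / 2) * Real.log ε) ≤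
      viscousPotential φ ε t x := by
  have h1ε : 0 < 1 - ε := by linarith
  have hts : t ≤ t / (1 - ε) := by
    rw [le_div_iff₀ h1ε]
    nlinarith
  have hdiff : t / (1 - ε) - t ≤ 2 * t * ε := by
    rw [sub_le_iff_le_add, div_le_iff₀ h1ε]
    nlinarith [mul_pos ht hε]
  set U := hopfLax φ t x - K ^ 2 * t * ε with hU
  have hU2 : U ≤ hopfLax φ (t / (1 - ε)) x := by
    have h1 := hopfLax_le_add hLip ht hts x
    have h2 : (K : ℝ) ^ 2 / 2 * (t / (1 - ε) - t) ≤ K ^ 2 / 2 * (2 * t * ε) := by gcongr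
    linarith
  have hpt : ∀ z : Space d, gibbsDensity φ ε t x (x - z) ≤
      Real.exp (-U / ε) * Real.exp (-(1 / (2 * t)) * ‖z‖ ^ 2) := by
    intro z
    rw [gibbsDensity, ← Real.exp_add, Real.exp_le_exp, sub_sub_cancel]
    have h1 := hU2.trans (hopfLax_le hLip (by positivity : 0 < t / (1 - ε)) x (x - z))
    rw [sub_sub_cancel] at h1
    have h2 := div_le_div_of_nonneg_right h1 hε.le
    have h3 : (‖z‖ ^ 2 / (2 * (t / (1 - ε))) + φ (x - z)) / ε =
        ‖z‖ ^ 2 / (2 * ε * t) - 1 / (2 * t) * ‖z‖ ^ 2 + φ (x - z) / ε := by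
      field_simp
    rw [h3] at h2
    have h4 : -‖z‖ ^ 2 / (2 * ε * t) = -(‖z‖ ^ 2 / (2 * ε * t)) := by ring
    have h5 : -U / ε = -(U / ε) := by ring
    linarith
  have hgi := integrable_exp_neg_mul_sq_norm (d := d) (a := 1 / (2 * t)) (by positivity)
  have hW : ∫ z, gibbsDensity φ ε t x z ≤
      Real.exp (-U / ε) * (Real.pi / (1 / (2 * t))) ^ ((d : ℝ) / 2) := by
    have h3 := GaussianFourier.integral_rexp_neg_mul_sq_norm (V := Space d)
      (b := 1 / (2 * t)) (by positivity)
    rw [finrank_euclideanSpace, Fintype.card_fin] at h3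
    rw [← h3, ← integral_const_mul, ← integral_sub_left_eq_self _ volume x]
    exact integral_mono ((integrable_gibbsDensity hLip hε ht x).comp_sub_left x)
      (hgi.const_mul _) hpt
  have hlog := Real.log_le_log (integral_gibbsDensity_pos hLip hε ht x) hW
  rw [Real.log_mul (by positivity) (by positivity), Real.log_exp, Real.log_rpow (by positivity)]
    at hlog
  have hlogb : Real.log (Real.pi / (1 / (2 * t))) =
      Real.log (2 * Real.pi * ε * t) - Real.log ε := by
    rw [← Real.log_div (by positivity) hε.ne']
    congr 1
    field_simp
  rw [hlogb] at hlog
  rw [viscousPotential_eq_add hLip hε ht]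
  have h6 := mul_le_mul_of_nonneg_left hlog hε.le
  have h7 : ε * (-U / ε + (d : ℝ) / 2 * (Real.log (2 * Real.pi * ε * t) - Real.log ε)) =
      -U + ε * ((d : ℝ) / 2) * (Real.log (2 * Real.pi * ε * t) - Real.log ε) := by
    field_simp
  rw [h7] at h6
  linarith

/-- The viscous potentials converge to the Hopf-Lax potential, uniformly on `(0, T] × ℝ^d`. -/
theorem exists_abs_viscousPotential_sub_hopfLax_le (hLip : LipschitzWith K φ) {T : ℝ}
    (hT : 0 < T) :
    ∃ δ : ℝ → ℝ, Tendsto δ (𝓝[>] 0) (𝓝 0) ∧ ∀ ε, 0 < ε → ε ≤ 1 / 2 → ∀ t, 0 < t → t ≤ T → ∀ x,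
      |viscousPotential φ ε t x - hopfLax φ t x| ≤ δ ε := by
  refine ⟨fun ε => K ^ 2 * T * ε + ε * K ^ 2 / 2 + ((d : ℝ) / 2) * (ε * Real.log (ε + T)) -
    (d : ℝ) * (ε * Real.log ε), ?_, ?_⟩
  · refine tendsto_nhdsWithin_of_tendsto_nhds ?_
    have hc : ContinuousAt (fun ε : ℝ => K ^ 2 * T * ε + ε * K ^ 2 / 2 +
        ((d : ℝ) / 2) * (ε * Real.log (ε + T)) - (d : ℝ) * (ε * Real.log ε)) 0 := by
      have h1 : ContinuousAt (fun ε : ℝ => Real.log (ε + T)) 0 :=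
        ContinuousAt.log (by fun_prop) (by simpa using hT.ne')
      have h2 : ContinuousAt (fun ε : ℝ => ε * Real.log ε) 0 := Real.continuous_mul_log.continuousAt
      fun_prop
    simpa [ContinuousAt] using hc
  · intro ε hε hε2 t ht htT x
    have h1 := viscousPotential_le hLip hε ht x
    have h2 := le_viscousPotential hLip hε hε2 ht x
    have h3 : Real.log (ε + t) ≤ Real.log (ε + T) := Real.log_le_log (by positivity) (by linarith)
    have h4 : Real.log ε ≤ Real.log (ε + T) := Real.log_le_log hε (by linarith)
    have h5 : Real.log ε ≤ 0 := Real.log_nonpos hε.le (by linarith)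
    have hd : (0 : ℝ) ≤ ε * ((d : ℝ) / 2) := by positivity
    have h6 := mul_le_mul_of_nonneg_left h3 hd
    have h7 := mul_le_mul_of_nonneg_left h4 hd
    have h8 := mul_le_mul_of_nonneg_left h5 hd
    have h9 : (K : ℝ) ^ 2 * t * ε ≤ K ^ 2 * T * ε := by gcongr
    have h10 : 0 ≤ ε * (K : ℝ) ^ 2 / 2 := by positivity
    have h11 : 0 ≤ (K : ℝ) ^ 2 * T * ε := by positivity
    rw [abs_le]
    constructor <;> nlinarith
end

/-! ### Stability of the differential inclusion. -/

/-- Each paraboloid inequality is evaluated at the contact point of the other and the two are added.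
Exchanging f for g costs δ at each of the two points. -/
theorem inner_sub_le_of_mem_differential {mu δ : ℝ} {f g : Space d → ℝ}
    (hfg : ∀ z, |f z - g z| ≤ δ) {x y p q : Space d} (hp : p ∈ differential mu f x)
    (hq : q ∈ differential mu g y) : inner ℝ (x - y) (p - q) ≤ mu * ‖x - y‖ ^ 2 + 2 * δ := by
  have h1 := hp y
  have h2 := hq x
  have h3 := (abs_le.1 (hfg x)).2
  have h4 := (abs_le.1 (hfg y)).1
  have h5 : inner ℝ p (y - x) = -inner ℝ (x - y) p := by
    rw [← neg_sub x y, inner_neg_right, real_inner_comm]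
  rw [norm_sub_rev y x, h5] at h1
  rw [real_inner_comm] at h2
  rw [inner_sub_right]
  linarith

/-- A function which is absolutely continuous on `[a, b]` and has derivative at most `c` almost
everywhere grows at most by `c * (b - a)`. -/
theorem _root_.AbsolutelyContinuousOnInterval.sub_le_of_deriv_le {h : ℝ → ℝ} {a b c : ℝ}
    (hab : a ≤ b) (hh : AbsolutelyContinuousOnInterval h a b)
    (hd : ∀ᵐ t, t ∈ Ioo a b → deriv h t ≤ c) : h b - h a ≤ c * (b - a) := by
  rw [← hh.integral_deriv_eq_sub]
  have h1 : ∫ t in a..b, deriv h t ≤ ∫ _t in a..b, c := by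
    refine intervalIntegral.integral_mono_ae_restrict hab hh.intervalIntegrable_deriv
      intervalIntegrable_const ?_
    rw [← restrict_Ioo_eq_restrict_Icc]
    exact (ae_restrict_iff' measurableSet_Ioo).2 hd
  refine h1.trans (le_of_eq ?_)
  rw [intervalIntegral.integral_const, smul_eq_mul, mul_comm]

/-- Stability of the differential inclusion `x' ∈ ∂f_t(x)` for `lam / (1 + lam * t)`-concave
potentials, under uniformly small changes of the potential. -/
theorem sq_norm_sub_le_of_mem_differential {lam : ℝ} (hlam : 0 ≤ lam) {a b δ : ℝ} (ha : 0 ≤ a)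
    (hab : a ≤ b) {f g : ℝ → Space d → ℝ} (hfg : ∀ t ∈ Ioo a b, ∀ z, |f t z - g t z| ≤ δ)
    {x y : ℝ → Space d} {Lx Ly : ℝ≥0} (hx : LipschitzOnWith Lx x (Icc a b))
    (hy : LipschitzOnWith Ly y (Icc a b))
    (hx' : ∀ᵐ t, t ∈ Ioo a b →
      ∃ p ∈ differential (lam / (1 + lam * t)) (f t) (x t), HasDerivAt x p t)
    (hy' : ∀ᵐ t, t ∈ Ioo a b →
      ∃ q ∈ differential (lam / (1 + lam * t)) (g t) (y t), HasDerivAt y q t) :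
    ‖x b - y b‖ ^ 2 / (1 + lam * b) ^ 2 ≤
      ‖x a - y a‖ ^ 2 / (1 + lam * a) ^ 2 + 4 * δ * (b - a) := by
  set h : ℝ → ℝ := fun t => ‖x t - y t‖ ^ 2 / (1 + lam * t) ^ 2 with hh
  have hac : AbsolutelyContinuousOnInterval h a b := by
    have h1 : LipschitzOnWith (Lx + Ly) (fun t => ‖x t - y t‖) (uIcc a b) := by
      rw [uIcc_of_le hab]
      have := lipschitzWith_one_norm.comp_lipschitzOnWith (hx.sub hy)
      simpa [Function.comp_def] using this
    have h2 : ContDiffOn ℝ 1 (fun t : ℝ => (1 + lam * t)⁻¹) (uIcc a b) := by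
      refine ContDiffOn.inv (by fun_prop) fun t ht => ?_
      rw [uIcc_of_le hab] at ht
      have : 0 ≤ lam * t := mul_nonneg hlam (ha.trans ht.1)
      positivity
    have a1 := h1.absolutelyContinuousOnInterval
    have a2 := h2.absolutelyContinuousOnInterval
    have a3 := (a1.mul a1).mul (a2.mul a2)
    convert a3 using 1
    ext t
    simp only [hh, Pi.mul_apply]
    rw [div_eq_mul_inv, sq, sq, mul_inv]
  have hd : ∀ᵐ t, t ∈ Ioo a b → deriv h t ≤ 4 * δ := by
    filter_upwards [hx', hy'] with t h1 h2 ht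
    obtain ⟨p, hp, hxp⟩ := h1 ht
    obtain ⟨q, hq, hyq⟩ := h2 ht
    have hA1 : 1 ≤ 1 + lam * t := by
      have := mul_nonneg hlam (ha.trans ht.1.le)
      linarith
    have hA : 0 < 1 + lam * t := by linarith
    have hδ : 0 ≤ δ := (abs_nonneg _).trans (hfg t ht 0)
    have hin := inner_sub_le_of_mem_differential (hfg t ht) hp hq
    have e1 := (hxp.sub hyq).norm_sq
    have e2 : HasDerivAt (fun t => (1 + lam * t) ^ 2) (2 * (1 + lam * t) * lam) t := by
      have := (((hasDerivAt_id t).const_mul lam).const_add 1).fun_pow 2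
      simpa using this
    have e3 : HasDerivAt h _ t := e1.fun_div e2 (by positivity)
    rw [e3.deriv]
    simp only [Pi.sub_apply]
    set A := 1 + lam * t
    set N := ‖x t - y t‖ ^ 2
    set P := inner ℝ (x t - y t) (p - q)
    rw [div_le_iff₀ (by positivity)]
    -- The term λN is exactly what differentiating the weight 1/A² cancels. The remaining 4δ/A² is
    -- at most 4δ because A ≥ 1.
    have hPA : P * A ≤ lam * N + 2 * δ * A := by
      have := mul_le_mul_of_nonneg_right hin hA.le
      have e : (lam / A * N + 2 * δ) * A = lam * N + 2 * δ * A := by field_simp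
      linarith
    have h5 := mul_le_mul_of_nonneg_right hPA hA.le
    have h6 : δ * A ^ 2 ≤ δ * A ^ 4 := by
      have : A ^ 2 ≤ A ^ 4 := pow_le_pow_right₀ hA1 (by norm_num)
      gcongr
    nlinarith
  have := hac.sub_le_of_deriv_le hab hd
  simp only [hh] at this
  linarith

/-! ### Existence, uniqueness and surjectivity of the viscous flow. -/

/-- `x` is a trajectory of the viscous velocity field on the time interval `[0, T]`. -/
structure IsViscousPath (φ : Space d → ℝ) (ε T : ℝ) (x : ℝ → Space d) : Prop where
  continuousOn : ContinuousOn x (Icc 0 T)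
  hasDerivAt : ∀ t ∈ Ioo 0 T, HasDerivAt x (gradient (viscousPotential φ ε t) (x t)) t

section

variable {φ : Space d → ℝ} {K : ℝ≥0} {lam ε T : ℝ}

theorem IsViscousFlow.isViscousPath {Z : Space d → ℝ → Space d} (hZ : IsViscousFlow φ ε Z)
    (y : Space d) (T : ℝ) : IsViscousPath φ ε T (Z y) where
  continuousOn := (hZ.continuousOn y).mono Icc_subset_Ici_self
  hasDerivAt t ht := hZ.hasDerivAt y t ht.1

namespace IsViscousPath

theorem mono {x : ℝ → Space d} (hx : IsViscousPath φ ε T x) {S : ℝ} (hS : S ≤ T) :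
    IsViscousPath φ ε S x where
  continuousOn := hx.continuousOn.mono (Icc_subset_Icc_right hS)
  hasDerivAt t ht := hx.hasDerivAt t ⟨ht.1, ht.2.trans_le hS⟩

theorem lipschitzOnWith (hLip : LipschitzWith K φ) (hε : 0 < ε) {x : ℝ → Space d}
    (hx : IsViscousPath φ ε T x) : LipschitzOnWith K x (Icc 0 T) := by
  rcases le_or_gt T 0 with hT | hT
  · intro s hs t ht
    rw [subsingleton_Icc_of_ge hT hs ht]
    simp
  have h1 : LipschitzOnWith K x (Ioo 0 T) := by
    refine (convex_Ioo 0 T).lipschitzOnWith_of_nnnorm_hasDerivWithin_le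
      (fun t ht => (hx.hasDerivAt t ht).hasDerivWithinAt) fun t ht => ?_
    exact norm_gradient_viscousPotential_le hLip hε ht.1 _
  rw [← closure_Ioo hT.ne]
  refine LipschitzOnWith.closure ?_ h1
  rw [closure_Ioo hT.ne]
  exact hx.continuousOn

theorem inclusion (hlam : 0 ≤ lam) (hLip : LipschitzWith K φ) (hconc : LambdaConcave lam φ)
    (hε : 0 < ε) {x : ℝ → Space d} (hx : IsViscousPath φ ε T x) :
    ∀ᵐ t, t ∈ Ioo 0 T → ∃ p ∈ differential (lam / (1 + lam * t)) (viscousPotential φ ε t) (x t),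
      HasDerivAt x p t :=
  ae_of_all _ fun t ht => ⟨_,
    gradient_viscousPotential_mem_differential hlam hLip hconc hε ht.1 _, hx.hasDerivAt t ht⟩

/-- Uniqueness comes from stability with δ = 0, so no Lipschitz bound on the velocity near t = 0 is
needed. -/
theorem eqOn (hlam : 0 ≤ lam) (hLip : LipschitzWith K φ) (hconc : LambdaConcave lam φ)
    (hε : 0 < ε) {x y : ℝ → Space d} (hx : IsViscousPath φ ε T x) (hy : IsViscousPath φ ε T y)
    (h0 : x 0 = y 0) : EqOn x y (Icc 0 T) := by
  intro t ht
  have hx' := hx.mono ht.2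
  have hy' := hy.mono ht.2
  have h := sq_norm_sub_le_of_mem_differential hlam le_rfl ht.1 (δ := 0) (by simp)
    (hx'.lipschitzOnWith hLip hε) (hy'.lipschitzOnWith hLip hε)
    (hx'.inclusion hlam hLip hconc hε) (hy'.inclusion hlam hLip hconc hε)
  have hA : 0 < (1 + lam * t) ^ 2 := by
    have := mul_nonneg hlam ht.1
    positivity
  rw [h0, sub_self, norm_zero, div_le_iff₀ hA] at h
  have h2 : ‖x t - y t‖ ^ 2 = 0 := le_antisymm (by simpa using h) (sq_nonneg _)
  exact sub_eq_zero.1 (norm_eq_zero.1 (pow_eq_zero_iff two_ne_zero |>.1 h2))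

end IsViscousPath

/-- After the change of time `t = s ^ 2` the viscous velocity field is bounded and Lipschitz up to
the initial time. -/
theorem exists_isViscousPath (hLip : LipschitzWith K φ) (hε : 0 < ε) {t₀ : ℝ}
    (ht₀ : t₀ ∈ Icc 0 T) (y : Space d) : ∃ x, IsViscousPath φ ε T x ∧ x t₀ = y := by
  obtain ⟨M, C, hM, hC⟩ := exists_bounds_scaledMean (d := d) hLip hε (√T)
  have hs₀ : √t₀ ∈ Icc 0 (√T) := ⟨Real.sqrt_nonneg _, Real.sqrt_le_sqrt ht₀.2⟩
  -- The bounds are global in x, so a ball of radius 2M√T contains the solution over the whole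
  -- interval, wherever in it the datum is prescribed.
  have hPL : IsPicardLindelof (fun s x => (2 : ℝ) • scaledMean φ ε s x)
      (⟨√t₀, hs₀⟩ : Icc 0 (√T)) y (2 * M * ⟨√T, Real.sqrt_nonneg _⟩) 0 (2 * M) (2 * C) := by
    refine ⟨fun s hs => ?_, fun x _ => ?_, fun s hs x _ => ?_, ?_⟩
    · refine (LipschitzWith.of_dist_le_mul fun x x' => ?_).lipschitzOnWith
      rw [dist_eq_norm, dist_eq_norm, ← smul_sub, norm_smul]
      have := hC s hs s hs x x'
      simp only [sub_self, abs_zero, add_zero] at this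
      push_cast
      rw [Real.norm_ofNat]
      linarith
    · have h1 : LipschitzOnWith (2 * C) (fun s => (2 : ℝ) • scaledMean φ ε s x) (Icc 0 (√T)) := by
        refine LipschitzOnWith.of_dist_le_mul fun s hs s' hs' => ?_
        rw [dist_eq_norm, Real.dist_eq, ← smul_sub, norm_smul]
        have := hC s hs s' hs' x x
        simp only [sub_self, norm_zero, zero_add] at this
        push_cast
        rw [Real.norm_ofNat]
        linarith
      exact h1.continuousOn
    · rw [norm_smul, Real.norm_ofNat]
      push_cast
      exact mul_le_mul_of_nonneg_left (hM s hs x) zero_le_two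
    · show 2 * (M : ℝ) * max (√T - √t₀) (√t₀ - 0) ≤ 2 * (M : ℝ) * √T - 0
      rw [sub_zero, sub_zero]
      exact mul_le_mul_of_nonneg_left (max_le (by linarith [hs₀.1]) hs₀.2) (by positivity)
  obtain ⟨α, hα0, hα⟩ := hPL.exists_eq_forall_mem_Icc_hasDerivWithinAt₀
  refine ⟨fun t => α (√t), ⟨?_, fun t ht => ?_⟩, hα0⟩
  · have h1 : ContinuousOn α (Icc 0 (√T)) := fun s hs => (hα s hs).continuousWithinAt
    exact h1.comp Real.continuous_sqrt.continuousOn fun t ht =>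
      ⟨Real.sqrt_nonneg _, Real.sqrt_le_sqrt ht.2⟩
  · have hs : 0 < √t := Real.sqrt_pos.2 ht.1
    have hsS : √t < √T := Real.sqrt_lt_sqrt ht.1.le ht.2
    have h1 : HasDerivAt α _ (√t) := (hα (√t) ⟨hs.le, hsS.le⟩).hasDerivAt (Icc_mem_nhds hs hsS)
    have h2 := h1.scomp t (Real.hasDerivAt_sqrt ht.1.ne')
    have h3 := gradient_viscousPotential_eq hLip hε hs (α √t)
    rw [Real.sq_sqrt ht.1.le] at h3
    rw [h3]
    refine h2.congr_deriv ?_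
    rw [smul_smul]
    congr 1
    field_simp

theorem exists_isViscousFlow (hlam : 0 ≤ lam) (hLip : LipschitzWith K φ)
    (hconc : LambdaConcave lam φ) (hε : 0 < ε) :
    ∃ Z : Space d → ℝ → Space d, IsViscousFlow φ ε Z := by
  have hex : ∀ (y : Space d) (n : ℕ), ∃ x, IsViscousPath φ ε n x ∧ x 0 = y := fun y n =>
    exists_isViscousPath hLip hε ⟨le_rfl, Nat.cast_nonneg n⟩ y
  choose P hP hP0 using hex
  -- The paths on [0, n] agree by uniqueness, so any n ≥ t gives the same value.
  set Z : Space d → ℝ → Space d := fun y t => P y ⌈t⌉₊ t with hZ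
  have hagree : ∀ y (n : ℕ), ∀ t ∈ Icc (0 : ℝ) n, Z y t = P y n t := by
    intro y n t ht
    have hle : ⌈t⌉₊ ≤ n := Nat.ceil_le.2 ht.2
    refine (hP y ⌈t⌉₊).eqOn hlam hLip hconc hε ((hP y n).mono (Nat.cast_le.2 hle)) ?_
      ⟨ht.1, Nat.le_ceil t⟩
    rw [hP0, hP0]
  have hpath : ∀ y (n : ℕ), IsViscousPath φ ε n (Z y) := by
    intro y n
    refine ⟨(hP y n).continuousOn.congr (hagree y n), fun t ht => ?_⟩
    rw [hagree y n t ⟨ht.1.le, ht.2.le⟩]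
    refine ((hP y n).hasDerivAt t ht).congr_of_eventuallyEq ?_
    filter_upwards [Icc_mem_nhds ht.1 ht.2] with s hs using hagree y n s hs
  refine ⟨Z, fun y => ?_, fun y t ht => ?_, fun y t ht => ?_⟩
  · simp [hZ, hP0]
  · obtain ⟨n, hn⟩ := exists_nat_gt t
    have h1 := (hpath y n).continuousOn t ⟨ht, hn.le⟩
    refine h1.mono_of_mem_nhdsWithin ?_
    rw [← Ici_inter_Iic]
    exact inter_mem_nhdsWithin _ (Iic_mem_nhds hn)
  · obtain ⟨n, hn⟩ := exists_nat_gt t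
    exact (hpath y n).hasDerivAt t ⟨ht, hn⟩

/-- The path with terminal value y at time T is a trajectory; by uniqueness it is the flow line of
its own initial point. -/
theorem IsViscousFlow.surjective (hlam : 0 ≤ lam) (hLip : LipschitzWith K φ)
    (hconc : LambdaConcave lam φ) (hε : 0 < ε) {Z : Space d → ℝ → Space d}
    (hZ : IsViscousFlow φ ε Z) (hT : 0 ≤ T) : Function.Surjective fun y => Z y T := by
  intro y
  obtain ⟨x, hx, hxT⟩ := exists_isViscousPath (T := T) hLip hε ⟨hT, le_rfl⟩ y
  exact ⟨x 0, ((hZ.isViscousPath (x 0) T).eqOn hlam hLip hconc hε hx (hZ.initial _)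
    ⟨hT, le_rfl⟩).trans hxT⟩

end

/-! ### Passing to the limit in the differential inclusion. -/

section

variable {φ : Space d → ℝ} {K : ℝ≥0} {lam ε T : ℝ}

theorem continuousAt_hopfLax_comp (hLip : LipschitzWith K φ) {x : ℝ → Space d} {t : ℝ} (ht : 0 < t)
    (hx : ContinuousAt x t) : ContinuousAt (fun s => hopfLax φ s (x s)) t := by
  rw [ContinuousAt, tendsto_iff_norm_sub_tendsto_zero]
  have h1 : Tendsto (fun s => K * ‖x s - x t‖ + K ^ 2 / 2 * |s - t|) (𝓝 t) (𝓝 0) := by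
    have h2 : ContinuousAt (fun s => K * ‖x s - x t‖ + K ^ 2 / 2 * |s - t|) t := by fun_prop
    simpa [ContinuousAt] using h2
  refine squeeze_zero' (Eventually.of_forall fun _ => norm_nonneg _) ?_ h1
  filter_upwards [Ioi_mem_nhds ht] with s hs
  exact abs_hopfLax_sub_le hLip hs ht _ _

theorem hasDerivAt_neg_half_sq_norm_sub {x : ℝ → Space d} {v z : Space d} {t : ℝ}
    (hx : HasDerivAt x v t) :
    HasDerivAt (fun s => -(1 / 2) * ‖x s - z‖ ^ 2) (inner ℝ v (z - x t)) t := by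
  refine ((hx.sub_const z).norm_sq.const_mul (-(1 / 2) : ℝ)).congr_deriv ?_
  rw [← neg_sub (x t) z, inner_neg_right, real_inner_comm]
  ring

/-- A uniform limit of viscous trajectories solves the inviscid differential inclusion wherever it
is differentiable. -/
theorem mem_differential_of_tendsto (hlam : 0 ≤ lam) (hLip : LipschitzWith K φ)
    (hconc : LambdaConcave lam φ) {e : ℕ → ℝ} (he : ∀ n, 0 < e n) {xn : ℕ → ℝ → Space d}
    (hxn : ∀ n, IsViscousPath φ (e n) T (xn n)) {x : ℝ → Space d} {r δ : ℕ → ℝ}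
    (hr : Tendsto r atTop (𝓝 0)) (hδ : Tendsto δ atTop (𝓝 0))
    (hxr : ∀ n, ∀ s ∈ Icc 0 T, ‖xn n s - x s‖ ≤ r n)
    (hu : ∀ n, ∀ s, 0 < s → s ≤ T → ∀ z,
      |viscousPotential φ (e n) s z - hopfLax φ s z| ≤ δ n)
    {t : ℝ} (ht : t ∈ Ioo 0 T) {v : Space d} (hv : HasDerivAt x v t) :
    v ∈ differential (lam / (1 + lam * t)) (hopfLax φ t) (x t) := by
  intro z
  -- The claim at z is G(t) ≤ v · (z - x_t), and the right side is the derivative of -|x - z|²/2 at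
  -- t. Along the viscous paths that derivative is at least G up to a vanishing error. Integrating
  -- over [t, s] and letting n → ∞, then s ↓ t, gives the claim without convergence of velocities.
  set G : ℝ → ℝ := fun s => hopfLax φ s z - hopfLax φ s (x s) -
    lam / (1 + lam * s) / 2 * ‖z - x s‖ ^ 2 with hG
  suffices h : G t ≤ inner ℝ v (z - x t) by
    simp only [hG] at h
    linarith
  have hA : ∀ s, 0 < s → 0 < 1 + lam * s := fun s hs => by positivity
  have hGc : ContinuousAt G t := by
    have h1 := continuousAt_hopfLax_comp hLip ht.1 hv.continuousAt
    have h2 := continuousAt_hopfLax_comp hLip ht.1 (continuousAt_const (y := z))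
    have h3 : ContinuousAt (fun s => lam / (1 + lam * s)) t :=
      ContinuousAt.div (by fun_prop) (by fun_prop) (hA t ht.1).ne'
    have h4 := hv.continuousAt
    fun_prop
  refine le_of_forall_lt_imp_le_of_dense fun c hc => ?_
  obtain ⟨c', hcc', hc'⟩ := exists_between hc
  have hev : ∀ᶠ s in 𝓝 t, c' < G s ∧ ‖z - x s‖ < ‖z - x t‖ + 1 ∧ s < T := by
    refine (hGc.eventually (lt_mem_nhds hc')).and (Eventually.and ?_ (Iio_mem_nhds ht.2))
    have h4 : ContinuousAt (fun s => ‖z - x s‖) t := by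
      have := hv.continuousAt
      fun_prop
    exact h4.eventually (gt_mem_nhds (lt_add_one _))
  obtain ⟨η, hη, hball⟩ := Metric.eventually_nhds_iff.1 hev
  set R := ‖z - x t‖ + 1 with hR
  have hseg : ∀ s ∈ Ico t (t + η), c' < G s ∧ ‖z - x s‖ < R ∧ s < T := fun s hs => by
    refine hball ?_
    rw [Real.dist_eq, abs_of_nonneg (sub_nonneg.2 hs.1)]
    linarith [hs.2]
  -- The errors come from exchanging the potentials at two points, from moving `hopfLax` from the
  -- viscous path to its limit, and from the change in the squared distance to z. The gap c' - c
  -- absorbs them.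
  have hsmall : ∀ᶠ n in atTop,
      2 * δ n + K * r n + lam / 2 * (r n * (2 * R + r n)) < c' - c := by
    have h1 : Tendsto (fun n => 2 * δ n + K * r n + lam / 2 * (r n * (2 * R + r n))) atTop
        (𝓝 (2 * 0 + K * 0 + lam / 2 * (0 * (2 * R + 0)))) :=
      ((hδ.const_mul 2).add (hr.const_mul (K : ℝ))).add
        ((hr.mul (hr.const_add (2 * R))).const_mul (lam / 2))
    refine h1.eventually (gt_mem_nhds ?_)
    simpa using hcc'
  have hinc : ∀ s ∈ Ioo t (t + η), c * (s - t) ≤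
      -(1 / 2) * ‖x s - z‖ ^ 2 - -(1 / 2) * ‖x t - z‖ ^ 2 := by
    intro s hs
    have hsT : s < T := (hseg s ⟨hs.1.le, hs.2⟩).2.2
    have hlim : ∀ s' ∈ Icc 0 T, Tendsto (fun n => -(1 / 2) * ‖xn n s' - z‖ ^ 2) atTop
        (𝓝 (-(1 / 2) * ‖x s' - z‖ ^ 2)) := by
      intro s' hs'
      have h1 : Tendsto (fun n => xn n s') atTop (𝓝 (x s')) := by
        rw [tendsto_iff_norm_sub_tendsto_zero]
        exact squeeze_zero (fun _ => norm_nonneg _) (fun n => hxr n s' hs') hr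
      exact ((h1.sub_const z).norm.pow 2).const_mul _
    refine ge_of_tendsto ((hlim s ⟨(ht.1.trans hs.1).le, hsT.le⟩).sub
      (hlim t ⟨ht.1.le, ht.2.le⟩)) ?_
    filter_upwards [hsmall] with n hn
    have hsub : Icc t s ⊆ Ioo 0 T := fun q hq => ⟨ht.1.trans_le hq.1, hq.2.trans_lt hsT⟩
    have hder : ∀ q ∈ Icc t s, HasDerivAt (fun s => -(1 / 2) * ‖xn n s - z‖ ^ 2)
        (inner ℝ (gradient (viscousPotential φ (e n) q) (xn n q)) (z - xn n q)) q :=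
      fun q hq => hasDerivAt_neg_half_sq_norm_sub ((hxn n).hasDerivAt q (hsub hq))
    refine (convex_Icc t s).mul_sub_le_image_sub_of_le_deriv
      (fun q hq => (hder q hq).continuousAt.continuousWithinAt)
      (fun q hq => (hder q (interior_subset hq)).differentiableAt.differentiableWithinAt)
      (fun q hq => ?_) t ⟨le_rfl, hs.1.le⟩ s ⟨hs.1.le, le_rfl⟩ hs.1.le
    replace hq := interior_subset hq
    rw [(hder q hq).deriv]
    obtain ⟨hq1, hq2, -⟩ := hseg q ⟨hq.1, hq.2.trans_lt hs.2⟩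
    have hq0 := (hsub hq).1
    have hqT := (hsub hq).2.le
    have b1 := gradient_viscousPotential_mem_differential hlam hLip hconc (he n) hq0 (xn n q) z
    have b2 := (abs_le.1 (hu n q hq0 hqT z)).1
    have b3 := (abs_le.1 (hu n q hq0 hqT (xn n q))).2
    have b4 := hxr n q ⟨hq0.le, hqT⟩
    have b5 := (lipschitzWith_hopfLax hLip hq0).le_add_mul_norm (xn n q) (x q)
    have b6 : K * ‖xn n q - x q‖ ≤ K * r n := by gcongr
    have hr0 : 0 ≤ r n := (norm_nonneg _).trans b4
    have b7 : ‖z - xn n q‖ ≤ ‖z - x q‖ + r n := by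
      have : z - xn n q = (z - x q) - (xn n q - x q) := by abel
      rw [this]
      exact (norm_sub_le _ _).trans (by gcongr)
    have b8 : ‖z - xn n q‖ ^ 2 ≤ ‖z - x q‖ ^ 2 + r n * (2 * R + r n) := by
      have := pow_le_pow_left₀ (norm_nonneg _) b7 2
      nlinarith
    have b9 : lam / (1 + lam * q) ≤ lam := by
      rw [div_le_iff₀ (hA q hq0)]
      nlinarith [mul_nonneg hlam (mul_nonneg hlam hq0.le)]
    have b10 : 0 ≤ lam / (1 + lam * q) := div_nonneg hlam (hA q hq0).le
    have hR0 : 0 ≤ r n * (2 * R + r n) := by positivity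
    have b11 : lam / (1 + lam * q) / 2 * ‖z - xn n q‖ ^ 2 ≤
        lam / (1 + lam * q) / 2 * ‖z - x q‖ ^ 2 + lam / 2 * (r n * (2 * R + r n)) := by
      calc _ ≤ lam / (1 + lam * q) / 2 * (‖z - x q‖ ^ 2 + r n * (2 * R + r n)) := by gcongr
        _ ≤ _ := by
          rw [mul_add]
          gcongr
    simp only [hG] at hq1
    linarith
  have hslope := (hasDerivAt_neg_half_sq_norm_sub (z := z) hv).hasDerivWithinAt (s := Ioi t)
  rw [hasDerivWithinAt_iff_tendsto_slope' self_notMem_Ioi] at hslope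
  refine ge_of_tendsto hslope ?_
  filter_upwards [Ioo_mem_nhdsGT (lt_add_of_pos_right t hη)] with s hs
  rw [slope_def_field, le_div_iff₀ (sub_pos.2 hs.1)]
  exact hinc s hs

end

/-! ### The vanishing viscosity limit and its properties. -/

section

variable {φ : Space d → ℝ} {K : ℝ≥0} {lam ε T : ℝ}

theorem norm_sub_le_of_mem_differential (hlam : 0 ≤ lam) {b δ : ℝ} (hb : b ∈ Icc 0 T)
    (hδ : 0 ≤ δ) {f g : ℝ → Space d → ℝ} (hfg : ∀ t ∈ Ioo 0 b, ∀ z, |f t z - g t z| ≤ δ)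
    {x y : ℝ → Space d} {Lx Ly : ℝ≥0} (hx : LipschitzOnWith Lx x (Icc 0 b))
    (hy : LipschitzOnWith Ly y (Icc 0 b))
    (hx' : ∀ᵐ t, t ∈ Ioo 0 b →
      ∃ p ∈ differential (lam / (1 + lam * t)) (f t) (x t), HasDerivAt x p t)
    (hy' : ∀ᵐ t, t ∈ Ioo 0 b →
      ∃ q ∈ differential (lam / (1 + lam * t)) (g t) (y t), HasDerivAt y q t)
    (h0 : x 0 = y 0) : ‖x b - y b‖ ≤ (1 + lam * T) * √(4 * δ * T) := by
  have h := sq_norm_sub_le_of_mem_differential hlam le_rfl hb.1 hfg hx hy hx' hy'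
  have hb0 := hb.1
  have hT0 : 0 ≤ T := hb.1.trans hb.2
  have hA : 0 < 1 + lam * b := by positivity
  rw [h0, sub_self, norm_zero, ← div_pow, sub_zero] at h
  have h1 : ‖x b - y b‖ / (1 + lam * b) ≤ √(4 * δ * T) := by
    refine Real.le_sqrt_of_sq_le (h.trans ?_)
    simp only [ne_eq, OfNat.ofNat_ne_zero, not_false_eq_true, zero_pow, zero_div, zero_add]
    gcongr
    exact hb.2
  rw [div_le_iff₀ hA] at h1
  refine h1.trans ?_
  rw [mul_comm]
  gcongr
  exact hb.2

namespace IsLipschitzSolution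

theorem ae_inclusion {x : ℝ → Space d} {y : Space d} (hx : IsLipschitzSolution φ lam y x) {a b : ℝ}
    (ha : 0 ≤ a) : ∀ᵐ t, t ∈ Ioo a b →
      ∃ p ∈ differential (lam / (1 + lam * t)) (hopfLax φ t) (x t), HasDerivAt x p t := by
  filter_upwards [(ae_restrict_iff' measurableSet_Ioi).1 hx.inclusion] with t h ht
  exact h (ha.trans_lt ht.1)

/-- Stability with both potentials equal to `hopfLax` and δ = 0. Uniqueness, stickiness and the
spatial Lipschitz bounds all follow from it. -/
theorem norm_sub_div_le (hlam : 0 ≤ lam) {x x' : ℝ → Space d} {y y' : Space d}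
    (hx : IsLipschitzSolution φ lam y x) (hx' : IsLipschitzSolution φ lam y' x') {a b : ℝ}
    (ha : 0 ≤ a) (hab : a ≤ b) :
    ‖x b - x' b‖ / (1 + lam * b) ≤ ‖x a - x' a‖ / (1 + lam * a) := by
  obtain ⟨L, hL⟩ := hx.lipschitz
  obtain ⟨L', hL'⟩ := hx'.lipschitz
  have hsub : Icc a b ⊆ Ici 0 := fun t ht => ha.trans ht.1
  have h := sq_norm_sub_le_of_mem_differential hlam ha hab (f := hopfLax φ) (g := hopfLax φ)
    (δ := 0) (by simp) (hL.mono hsub) (hL'.mono hsub) (hx.ae_inclusion ha) (hx'.ae_inclusion ha)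
  have hb : 0 ≤ b := ha.trans hab
  have h2 : 0 ≤ 1 + lam * a := by positivity
  have h3 : 0 ≤ 1 + lam * b := by positivity
  simp only [mul_zero, zero_mul, add_zero, ← div_pow] at h
  exact (sq_le_sq₀ (by positivity) (by positivity)).1 h

theorem eq_of_eq (hlam : 0 ≤ lam) {x x' : ℝ → Space d} {y y' : Space d}
    (hx : IsLipschitzSolution φ lam y x) (hx' : IsLipschitzSolution φ lam y' x') {a b : ℝ}
    (ha : 0 ≤ a) (hab : a ≤ b) (h : x a = x' a) : x b = x' b := by
  have h1 := hx.norm_sub_div_le hlam hx' ha hab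
  have hA : 0 < 1 + lam * b := by
    have := mul_nonneg hlam (ha.trans hab)
    positivity
  rw [h, sub_self, norm_zero, zero_div, div_le_iff₀ hA, zero_mul] at h1
  exact sub_eq_zero.1 (norm_le_zero_iff.1 h1)

end IsLipschitzSolution

/-- Viscous flows converge to solutions of the inviscid differential inclusion, at a rate that is
uniform in the initial point. -/
theorem exists_norm_viscousFlow_sub_le (hlam : 0 ≤ lam) (hLip : LipschitzWith K φ)
    (hconc : LambdaConcave lam φ) (hT : 0 < T) :
    ∃ ρ : ℝ → ℝ, Tendsto ρ (𝓝[>] 0) (𝓝 0) ∧ ∀ ε, 0 < ε → ε ≤ 1 / 2 → ∀ Z, IsViscousFlow φ ε Z →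
      ∀ y x, IsLipschitzSolution φ lam y x → ∀ t ∈ Icc 0 T, ‖Z y t - x t‖ ≤ ρ ε := by
  obtain ⟨δ, hδ, hu⟩ := exists_abs_viscousPotential_sub_hopfLax_le hLip hT
  refine ⟨fun ε => (1 + lam * T) * √(4 * δ ε * T), ?_, ?_⟩
  · have h1 : Tendsto (fun ε => (1 + lam * T) * √(4 * δ ε * T)) (𝓝[>] 0)
        (𝓝 ((1 + lam * T) * √(4 * 0 * T))) :=
      (((hδ.const_mul 4).mul_const T).sqrt).const_mul _
    simpa using h1
  · intro ε hε hε2 Z hZ y x hx t ht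
    obtain ⟨L, hL⟩ := hx.lipschitz
    have hp := hZ.isViscousPath y t
    refine norm_sub_le_of_mem_differential hlam ht
      ((abs_nonneg _).trans (hu ε hε hε2 T hT le_rfl 0))
      (fun s hs z => hu ε hε hε2 s hs.1 (hs.2.le.trans ht.2) z)
      (hp.lipschitzOnWith hLip hε) (hL.mono Icc_subset_Ici_self)
      (hp.inclusion hlam hLip hconc hε) (hx.ae_inclusion le_rfl) ?_
    rw [hZ.initial, hx.initial]

theorem IsViscousFlow.lipschitzOnWith (hLip : LipschitzWith K φ) (hε : 0 < ε)
    {Z : Space d → ℝ → Space d} (hZ : IsViscousFlow φ ε Z) (y : Space d) :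
    LipschitzOnWith K (Z y) (Ici 0) := by
  intro s hs t ht
  exact (hZ.isViscousPath y (max s t)).lipschitzOnWith hLip hε ⟨hs, le_max_left _ _⟩
    ⟨ht, le_max_right _ _⟩

theorem exists_seq_viscosity_tendsto_zero : ∃ e : ℕ → ℝ, (∀ n, 0 < e n) ∧ (∀ n, e n ≤ 1 / 2) ∧
    Tendsto e atTop (𝓝[>] 0) := by
  refine ⟨fun n => 1 / ((n : ℝ) + 2), fun n => by positivity, fun n => ?_,
    tendsto_nhdsWithin_iff.2 ⟨?_, Eventually.of_forall fun n => ?_⟩⟩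
  · exact one_div_le_one_div_of_le two_pos (by linarith [Nat.cast_nonneg (α := ℝ) n])
  · have h := (tendsto_add_atTop_iff_nat 2).2 (tendsto_one_div_atTop_nhds_zero_nat (𝕜 := ℝ))
    refine h.congr fun n => ?_
    push_cast
    rfl
  · exact mem_Ioi.2 (by positivity)

/-- The vanishing viscosity limit of the flows exists and solves the differential inclusion. -/
theorem exists_isLipschitzSolution (hlam : 0 ≤ lam) (hLip : LipschitzWith K φ)
    (hconc : LambdaConcave lam φ) (y : Space d) :
    ∃ x, IsLipschitzSolution φ lam y x ∧ LipschitzOnWith K x (Ici 0) := by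
  obtain ⟨e, he0, he2, helim⟩ := exists_seq_viscosity_tendsto_zero
  choose Z hZ using fun n => exists_isViscousFlow hlam hLip hconc (he0 n)
  have hdist : ∀ T : ℝ, 0 < T → ∃ δ : ℕ → ℝ, Tendsto δ atTop (𝓝 0) ∧
      (∀ n, ∀ s, 0 < s → s ≤ T → ∀ z,
        |viscousPotential φ (e n) s z - hopfLax φ s z| ≤ δ n) ∧
      ∀ n m, ∀ t ∈ Icc 0 T, ‖Z n y t - Z m y t‖ ≤ (1 + lam * T) * √(4 * (δ n + δ m) * T) := by
    intro T hT
    obtain ⟨δ, hδ, hu⟩ := exists_abs_viscousPotential_sub_hopfLax_le hLip hT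
    have hu' := fun n => hu (e n) (he0 n) (he2 n)
    have hδ0 : ∀ n, 0 ≤ δ (e n) := fun n => (abs_nonneg _).trans (hu' n T hT le_rfl 0)
    refine ⟨fun n => δ (e n), hδ.comp helim, hu', fun n m t ht => ?_⟩
    have hn := (hZ n).isViscousPath y t
    have hm := (hZ m).isViscousPath y t
    refine norm_sub_le_of_mem_differential hlam ht (add_nonneg (hδ0 n) (hδ0 m)) (fun s hs z => ?_)
      (hn.lipschitzOnWith hLip (he0 n)) (hm.lipschitzOnWith hLip (he0 m))
      (hn.inclusion hlam hLip hconc (he0 n)) (hm.inclusion hlam hLip hconc (he0 m)) ?_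
    · refine (abs_sub_le _ (hopfLax φ s z) _).trans (add_le_add ?_ ?_)
      · exact hu' n s hs.1 (hs.2.le.trans ht.2) z
      · rw [abs_sub_comm]
        exact hu' m s hs.1 (hs.2.le.trans ht.2) z
    · rw [(hZ n).initial, (hZ m).initial]
  have hlim : ∀ t, 0 ≤ t → ∃ p, Tendsto (fun n => Z n y t) atTop (𝓝 p) := by
    intro t ht
    obtain ⟨δ, hδ, -, hZd⟩ := hdist (t + 1) (by linarith)
    refine cauchySeq_tendsto_of_complete (cauchySeq_iff_tendsto_dist_atTop_0.2 ?_)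
    have h1 : Tendsto (fun p : ℕ × ℕ => (1 + lam * (t + 1)) * √(4 * (δ p.1 + δ p.2) * (t + 1)))
        atTop (𝓝 ((1 + lam * (t + 1)) * √(4 * (0 + 0) * (t + 1)))) := by
      rw [← prod_atTop_atTop_eq]
      exact ((((hδ.comp tendsto_fst).add (hδ.comp tendsto_snd)).const_mul 4).mul_const
        (t + 1)).sqrt.const_mul _
    simp only [add_zero, mul_zero, zero_mul, Real.sqrt_zero] at h1
    refine squeeze_zero (fun _ => dist_nonneg) (fun p => ?_) h1
    rw [dist_eq_norm]
    exact hZd p.1 p.2 t ⟨ht, by linarith⟩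
  choose! x hx using hlim
  have hxL : LipschitzOnWith K x (Ici 0) := by
    refine LipschitzOnWith.of_dist_le_mul fun s hs t ht => ?_
    exact le_of_tendsto ((hx s hs).dist (hx t ht)) (Eventually.of_forall fun n =>
      ((hZ n).lipschitzOnWith hLip (he0 n) y).dist_le_mul s hs t ht)
  refine ⟨x, ⟨⟨K, hxL⟩, ?_, ?_⟩, hxL⟩
  · refine tendsto_nhds_unique (hx 0 le_rfl) ?_
    simp only [(hZ _).initial]
    exact tendsto_const_nhds
  · rw [ae_restrict_iff' measurableSet_Ioi]
    -- Rademacher's theorem supplies the derivative; working up to time t + 1 makes t interior.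
    filter_upwards [hxL.ae_differentiableWithinAt_of_mem] with t hdiff ht
    have hv := ((hdiff (mem_Ici.2 (le_of_lt ht))).differentiableAt (Ici_mem_nhds ht)).hasDerivAt
    refine ⟨_, ?_, hv⟩
    have hT : 0 < t + 1 := by linarith [mem_Ioi.1 ht]
    obtain ⟨δ, hδ, hu, hZd⟩ := hdist (t + 1) hT
    -- The `+ 0` is the limit of δ m as m → ∞ in the Cauchy estimate.
    have hr : Tendsto (fun n => (1 + lam * (t + 1)) * √(4 * (δ n + 0) * (t + 1))) atTop
        (𝓝 0) := by
      have h1 := ((((hδ.add_const 0).const_mul 4).mul_const (t + 1)).sqrt).const_mul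
        (1 + lam * (t + 1))
      simpa using h1
    refine mem_differential_of_tendsto (T := t + 1) hlam hLip hconc he0
      (fun n => (hZ n).isViscousPath y (t + 1)) hr hδ (fun n s hs => ?_) hu
      ⟨ht, lt_add_one t⟩ hv
    refine le_of_tendsto_of_tendsto ((tendsto_const_nhds.sub (hx s hs.1)).norm)
      ((((hδ.const_add (δ n)).const_mul 4).mul_const (t + 1)).sqrt.const_mul
        (1 + lam * (t + 1))) (Eventually.of_forall fun m => ?_)
    exact hZd n m s hs

/-- Preimages of p under the viscous flows lie within Kt of p, so a subsequence converges to some y.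
Then X_t of these points tends to X_t(y) by the spatial Lipschitz bound, and to p because the
convergence rate does not depend on the initial point. -/
theorem surjective_of_isLipschitzSolution (hlam : 0 ≤ lam) (hLip : LipschitzWith K φ)
    (hconc : LambdaConcave lam φ) {X : Space d → ℝ → Space d}
    (hX : ∀ y, IsLipschitzSolution φ lam y (X y)) {t : ℝ} (ht : 0 ≤ t) :
    Function.Surjective fun y => X y t := by
  intro p
  obtain ⟨ρ, hρ, hρX⟩ := exists_norm_viscousFlow_sub_le (T := t + 1) hlam hLip hconc (by linarith)
  obtain ⟨e, he0, he2, helim⟩ := exists_seq_viscosity_tendsto_zero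
  choose Z hZ using fun n => exists_isViscousFlow hlam hLip hconc (he0 n)
  choose w hw using fun n => (hZ n).surjective hlam hLip hconc (he0 n) ht p
  simp only at hw
  have hball : ∀ n, w n ∈ Metric.closedBall p (K * t) := by
    intro n
    have h := ((hZ n).lipschitzOnWith hLip (he0 n) (w n)).dist_le_mul 0 self_mem_Ici t ht
    rw [(hZ n).initial, hw n, Real.dist_eq, zero_sub, abs_neg, abs_of_nonneg ht] at h
    exact Metric.mem_closedBall.2 h
  obtain ⟨y, -, σ, hσ, hwy⟩ := (isCompact_closedBall p (K * t)).tendsto_subseq hball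
  refine ⟨y, ?_⟩
  have hA : 0 < 1 + lam * t := by positivity
  have h1 : Tendsto (fun k => X (w (σ k)) t) atTop (𝓝 (X y t)) := by
    rw [tendsto_iff_norm_sub_tendsto_zero] at hwy ⊢
    have h2 : Tendsto (fun k => ‖(w ∘ σ) k - y‖ * (1 + lam * t)) atTop (𝓝 0) := by
      simpa using hwy.mul_const (1 + lam * t)
    refine squeeze_zero (fun _ => norm_nonneg _) (fun k => ?_) h2
    have h3 := (hX (w (σ k))).norm_sub_div_le hlam (hX y) le_rfl ht
    rw [div_le_iff₀ hA, (hX _).initial, (hX _).initial, mul_zero, add_zero, div_one] at h3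
    exact h3
  have h4 : Tendsto (fun k => X (w (σ k)) t) atTop (𝓝 p) := by
    rw [tendsto_iff_norm_sub_tendsto_zero]
    refine squeeze_zero (fun _ => norm_nonneg _) (fun k => ?_)
      ((hρ.comp helim).comp hσ.tendsto_atTop)
    have h5 := hρX _ (he0 (σ k)) (he2 (σ k)) _ (hZ (σ k)) (w (σ k)) _ (hX _) t ⟨ht, by linarith⟩
    rw [hw, norm_sub_rev] at h5
    exact h5
  exact tendsto_nhds_unique h1 h4

theorem tendstoUniformlyOn_viscousFlow (hlam : 0 ≤ lam) (hLip : LipschitzWith K φ)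
    (hconc : LambdaConcave lam φ) {X : Space d → ℝ → Space d}
    (hX : ∀ y, IsLipschitzSolution φ lam y (X y)) {Z : ℝ → Space d → ℝ → Space d}
    (hZ : ∀ ε > 0, IsViscousFlow φ ε (Z ε)) {C : Set (Space d × ℝ)} (hT : 0 < T)
    (hC : C ⊆ univ ×ˢ Icc 0 T) :
    TendstoUniformlyOn (fun ε p => Z ε p.1 p.2) (fun p => X p.1 p.2) (𝓝[>] 0) C := by
  obtain ⟨ρ, hρ, hρX⟩ := exists_norm_viscousFlow_sub_le hlam hLip hconc hT
  rw [Metric.tendstoUniformlyOn_iff]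
  intro η hη
  filter_upwards [hρ.eventually (gt_mem_nhds hη),
    Ioc_mem_nhdsGT (show (0 : ℝ) < 1 / 2 by norm_num)] with ε h1 h2 p hp
  rw [dist_comm, dist_eq_norm]
  exact (hρX ε h2.1 h2.2 _ (hZ ε h2.1) p.1 _ (hX p.1) p.2 (hC hp).2).trans_lt h1

theorem locallyLipschitzOn_of_isLipschitzSolution (hlam : 0 ≤ lam) {X : Space d → ℝ → Space d}
    (hX : ∀ y, IsLipschitzSolution φ lam y (X y)) (hK : ∀ y, LipschitzOnWith K (X y) (Ici 0)) :
    LocallyLipschitzOn (univ ×ˢ Ici 0) (fun p : Space d × ℝ => X p.1 p.2) := by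
  rintro ⟨y₀, t₀⟩ ⟨-, ht₀⟩
  have ht₀' : 0 ≤ t₀ := ht₀
  have hB : 0 ≤ 1 + lam * (t₀ + 1) := by positivity
  refine ⟨⟨1 + lam * (t₀ + 1), hB⟩ + K, (univ ×ˢ Ici 0) ∩ {p | p.2 < t₀ + 1}, ?_, ?_⟩
  · refine inter_mem self_mem_nhdsWithin (mem_nhdsWithin_of_mem_nhds ?_)
    exact (isOpen_lt continuous_snd continuous_const).mem_nhds (lt_add_one t₀)
  · refine LipschitzOnWith.of_dist_le_mul ?_
    rintro ⟨y, s⟩ ⟨⟨-, hs⟩, hs1⟩ ⟨z, t⟩ ⟨⟨-, ht⟩, -⟩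
    have hs0 : 0 ≤ s := hs
    have hA : 0 < 1 + lam * s := by positivity
    have h1 : dist (X y s) (X z s) ≤ (1 + lam * (t₀ + 1)) * dist y z := by
      have h := (hX y).norm_sub_div_le hlam (hX z) le_rfl hs0
      rw [div_le_iff₀ hA, (hX _).initial, (hX _).initial, mul_zero, add_zero, div_one] at h
      rw [dist_eq_norm, dist_eq_norm]
      refine h.trans ?_
      rw [mul_comm]
      gcongr
      exact hs1.le
    have h2 : dist (X z s) (X z t) ≤ K * dist s t := (hK z).dist_le_mul s hs t ht
    have h3 : dist y z ≤ dist (y, s) (z, t) := le_max_left _ _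
    have h4 : dist s t ≤ dist (y, s) (z, t) := le_max_right _ _
    calc dist (X y s) (X z t) ≤ dist (X y s) (X z s) + dist (X z s) (X z t) :=
          dist_triangle _ _ _
      _ ≤ (1 + lam * (t₀ + 1)) * dist (y, s) (z, t) + K * dist (y, s) (z, t) := by
          refine add_le_add (h1.trans ?_) (h2.trans ?_) <;> gcongr
      _ = _ := by
          rw [← add_mul]
          rfl

end

end Adhesion

end

theorem theorem2p4 {d : ℕ} (φ : Adhesion.Space d → ℝ) (K : NNReal) (lam : ℝ) (hlam : 0 ≤ lam)
    (hLip : LipschitzWith K φ) (hconc : Adhesion.LambdaConcave lam φ) :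
    -- for every `ε > 0` the viscous Lagrangian flow `X^ε` exists and is unique on `[0, ∞)`
    (∀ ε > 0, ∃ Z : Adhesion.Space d → ℝ → Adhesion.Space d, Adhesion.IsViscousFlow φ ε Z ∧
      ∀ Z', Adhesion.IsViscousFlow φ ε Z' → ∀ y, ∀ t ≥ 0, Z' y t = Z y t) ∧
    ∃ X : Adhesion.Space d → ℝ → Adhesion.Space d,
      -- (a) convergence of the viscous flows `X^ε`, locally uniformly
      (∀ Xε : ℝ → Adhesion.Space d → ℝ → Adhesion.Space d,
        (∀ ε > 0, Adhesion.IsViscousFlow φ ε (Xε ε)) →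
          (∀ y, ∀ t ≥ 0,
            Filter.Tendsto (fun ε => Xε ε y t) (nhdsWithin 0 (Set.Ioi 0)) (nhds (X y t))) ∧
          ∀ C : Set (Adhesion.Space d × ℝ), IsCompact C → C ⊆ Set.univ ×ˢ Set.Ici 0 →
            TendstoUniformlyOn (fun ε p => Xε ε p.1 p.2) (fun p => X p.1 p.2)
              (nhdsWithin 0 (Set.Ioi 0)) C) ∧
      -- (b) surjectivity
      (∀ t ≥ 0, Function.Surjective (fun y => X y t)) ∧
      -- (c) local Lipschitz continuity, in the form (i), (ii), with stickiness
      LocallyLipschitzOn (Set.univ ×ˢ Set.Ici 0)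
        (fun p : Adhesion.Space d × ℝ => X p.1 p.2) ∧
      (∀ y, LipschitzOnWith K (X y) (Set.Ici 0)) ∧
      (∀ s t, 0 ≤ s → s < t → ∀ y z,
        ‖X y t - X z t‖ / (1 + lam * t) ≤ ‖X y s - X z s‖ / (1 + lam * s) ∧
        ‖X y s - X z s‖ / (1 + lam * s) ≤ ‖y - z‖) ∧
      (∀ y z, ∀ s ≥ 0, X y s = X z s → ∀ t ≥ s, X y t = X z t) ∧
      -- (d) each path is the unique Lipschitz solution of the differential inclusion
      (∀ y, Adhesion.IsLipschitzSolution φ lam y (X y) ∧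
        ∀ x, Adhesion.IsLipschitzSolution φ lam y x → ∀ t ≥ 0, x t = X y t) := by
  refine ⟨fun ε hε => ?_, ?_⟩
  · obtain ⟨Z, hZ⟩ := Adhesion.exists_isViscousFlow hlam hLip hconc hε
    refine ⟨Z, hZ, fun Z' hZ' y t ht => ?_⟩
    exact (hZ'.isViscousPath y t).eqOn hlam hLip hconc hε (hZ.isViscousPath y t)
      ((hZ'.initial y).trans (hZ.initial y).symm) ⟨ht, le_rfl⟩
  · choose X hX hK using Adhesion.exists_isLipschitzSolution hlam hLip hconc
    refine ⟨X, fun Xε hXε => ⟨fun y t ht => ?_, fun C hC hCsub => ?_⟩,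
      fun t ht => Adhesion.surjective_of_isLipschitzSolution hlam hLip hconc hX ht,
      Adhesion.locallyLipschitzOn_of_isLipschitzSolution hlam hX hK, hK,
      fun s t hs hst y z => ⟨(hX y).norm_sub_div_le hlam (hX z) hs hst.le, ?_⟩,
      fun y z s hs h t hst => (hX y).eq_of_eq hlam (hX z) hs hst h,
      fun y => ⟨hX y, fun x hx t ht => hx.eq_of_eq hlam (hX y) le_rfl ht
        (hx.initial.trans (hX y).initial.symm)⟩⟩
    · have h := Adhesion.tendstoUniformlyOn_viscousFlow (T := t + 1) (C := {(y, t)}) hlam hLip hconc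
        hX hXε (by linarith)
        (Set.singleton_subset_iff.2 ⟨Set.mem_univ _, ht, (lt_add_one t).le⟩)
      exact h.tendsto_at (Set.mem_singleton _)
    -- Only the time coordinate of the compact set matters, as the rate is uniform in y.
    · obtain ⟨T, hT⟩ := (hC.image continuous_snd).bddAbove
      refine Adhesion.tendstoUniformlyOn_viscousFlow (T := max T 1) hlam hLip hconc hX hXε
        (by positivity) fun p hp => ⟨Set.mem_univ _, (hCsub hp).2, ?_⟩
      exact (hT (Set.mem_image_of_mem _ hp)).trans (le_max_left _ _)
    · have h := (hX y).norm_sub_div_le hlam (hX z) le_rfl hs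
      rwa [(hX y).initial, (hX z).initial, mul_zero, add_zero, div_one] at h
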